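/- Let $n\ge 4$ be an even integer and let $u\in C^\infty(\mathbb{R}^n)$ be real-valued. Consider the conformal metric $g=e^{2u}|dx|^2$ on $\mathbb{R}^n$, and let $R_g$ be its scalar curvature and $Q$ its Q-curvature, i.e. the function with $$(-\Delta)^{n/2}u=Qe^{nu}\quad\text{on }\mathbb{R}^n .$$ Suppose that $g$ is complete, that it has finite total Q-curvature, i.e. $Qe^{nu}\in L^1(\mathbb{R}^n)$, and that there are constants $C>0$ and $p\ge 0$ such that $$R_g(x)\ \ge\ C|x|^{-p}$$ for all $x$ outside some compact subset of $\mathbb{R}^n$. Then the volume entropy $$\tau(g):=\limsup_{r\to\infty}\frac{\log V_g(B_r(0))}{\log|B_r(0)|}$$ satisfies $$\tau(g)\le \min\left\{1,\frac p2\right\}.$$ Here $B_r(0)$ is the Euclidean ball of radius $r$ centred at the origin, $V_g(B_r(0))=\int_{B_r(0)}e^{nu}\,dx$ is its volume with respect to $g$, and $|B_r(0)|$ is its Euclidean volume. -/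

import Mathlib

open scoped ContDiff Manifold

/-- Euclidean space `ℝⁿ`. -/
abbrev EuclSp (n : ℕ) : Type := EuclideanSpace ℝ (Fin n)

/-- A field of bilinear forms on `ℝⁿ`, written in the global coordinates:
`g x i j` is the component `g_{ij}(x)`. -/
abbrev MetricField (n : ℕ) : Type := EuclSp n → Matrix (Fin n) (Fin n) ℝ

/-- The conformal metric `e^{2u} |dx|²`. -/
noncomputable def conformalMetric {n : ℕ} (u : EuclSp n → ℝ) : MetricField n :=
  fun x => Real.exp (2 * u x) • (1 : Matrix (Fin n) (Fin n) ℝ)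

/-- The coordinate partial derivative `∂_i f`. -/
noncomputable def partialD {n : ℕ} (i : Fin n) (f : EuclSp n → ℝ) (x : EuclSp n) : ℝ :=
  fderiv ℝ f x (EuclideanSpace.single i 1)

namespace MetricField

/-- Christoffel symbols of the second kind,
`Γ^k_{ij} = ½ ∑_l g^{kl} (∂_i g_{jl} + ∂_j g_{il} - ∂_l g_{ij})`. -/
noncomputable def christoffel {n : ℕ} (g : MetricField n) (k i j : Fin n) (x : EuclSp n) : ℝ :=
  (1 / 2) * ∑ l, (g x)⁻¹ k l *
    (partialD i (fun y => g y j l) x + partialD j (fun y => g y i l) x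
      - partialD l (fun y => g y i j) x)

/-- Ricci tensor in coordinates,
`Ric_{ij} = ∑_k (∂_k Γ^k_{ij} - ∂_j Γ^k_{ik}) + ∑_{k,l} (Γ^k_{kl} Γ^l_{ij} - Γ^k_{jl} Γ^l_{ik})`. -/
noncomputable def ricci {n : ℕ} (g : MetricField n) (i j : Fin n) (x : EuclSp n) : ℝ :=
  (∑ k, (partialD k (g.christoffel k i j) x - partialD j (g.christoffel k i k) x))
    + ∑ k, ∑ l, (g.christoffel k k l x * g.christoffel l i j x
        - g.christoffel k j l x * g.christoffel l i k x)

/-- Scalar curvature `R_g = ∑_{i,j} g^{ij} Ric_{ij}`. -/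
noncomputable def scalarCurvature {n : ℕ} (g : MetricField n) (x : EuclSp n) : ℝ :=
  ∑ i, ∑ j, (g x)⁻¹ i j * g.ricci i j x

/-- The Riemannian volume measure `dv_g = √(det g) dx`. -/
noncomputable def volumeMeasure {n : ℕ} (g : MetricField n) : MeasureTheory.Measure (EuclSp n) :=
  MeasureTheory.volume.withDensity (fun x => ENNReal.ofReal (Real.sqrt (g x).det))

/-- The length `√(g_x(v, v))` of a tangent vector `v` at `x`. -/
noncomputable def tangentNorm {n : ℕ} (g : MetricField n) (x v : EuclSp n) : ℝ :=
  Real.sqrt (∑ i, ∑ j, g x i j * v i * v j)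

/-- The geodesic distance of `g`: the infimum of the `g`-lengths of `C¹` paths joining two points.
The tangent spaces carry the norm of `g`, not the Euclidean one. -/
noncomputable def geodesicEDist {n : ℕ} (g : MetricField n) (x y : EuclSp n) : ENNReal :=
  @Manifold.riemannianEDist (EuclSp n) _ _ (EuclSp n) _ 𝓘(ℝ, EuclSp n) (EuclSp n) _ _
    (fun p => ⟨fun v => ENNReal.ofReal (g.tangentNorm p v)⟩) x y

/-- Completeness of `g`: every sequence that is Cauchy for the geodesic distance converges for the
geodesic distance. -/
def IsCompleteMetric {n : ℕ} (g : MetricField n) : Prop :=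
  ∀ s : ℕ → EuclSp n,
    (∀ ε : ENNReal, 0 < ε → ∃ N : ℕ, ∀ i ≥ N, ∀ j ≥ N, g.geodesicEDist (s i) (s j) < ε) →
    ∃ x : EuclSp n,
      Filter.Tendsto (fun k => g.geodesicEDist (s k) x) Filter.atTop (nhds 0)

/-- The volume entropy `τ(g) = limsup_{r → ∞} log V_g(B_r(0)) / log |B_r(0)|`, where `B_r(0)` is
the Euclidean ball. It is a limsup of extended reals, so it may be `±∞`. -/
noncomputable def volumeEntropy {n : ℕ} (g : MetricField n) : EReal :=
  Filter.limsup (fun r : ℝ =>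
    ((Real.log (g.volumeMeasure.real (Metric.ball 0 r))
      / Real.log (MeasureTheory.volume.real (Metric.ball (0 : EuclSp n) r)) : ℝ) : EReal))
    Filter.atTop

end MetricField

/-- The Q-curvature of `e^{2u} |dx|²` on `ℝⁿ`, `n` even, which is the function `Q` determined by
`(-Δ)^{n/2} u = Q e^{nu}`, with `Δ` the Euclidean Laplacian. -/
noncomputable def qCurvature {n : ℕ} (u : EuclSp n → ℝ) (x : EuclSp n) : ℝ :=
  Real.exp (-(n * u x)) *
    ((fun (f : EuclSp n → ℝ) (y : EuclSp n) => -Laplacian.laplacian f y)^[n / 2] u) x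

/-- `e^{2u} |dx|²` has finite total Q-curvature: `Q e^{nu} ∈ L¹(ℝⁿ)`. -/
def FiniteTotalQCurvature {n : ℕ} (u : EuclSp n → ℝ) : Prop :=
  MeasureTheory.Integrable (fun x => qCurvature u x * Real.exp (n * u x)) MeasureTheory.volume

/-!
Write `n = 2m`, `f = (-Δ)^m u ∈ L¹`, and `P = -2Δu - (n-2)|∇u|²`. For the metric `e^{2u}|dx|²` the
scalar curvature is `(n-1) e^{-2u} P`, so that the hypothesis reads `P ≥ c |x|^{-p} e^{2u}` near
infinity. The volume of the annulus `2R ≤ |x| ≤ 4R` is estimated after rescaling to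
`v(z) = u(R z)`, with constants that do not depend on `R`.

* Testing `P` with a squared cutoff at scale `R` and absorbing the cross term bounds the Dirichlet
  energy of `v` and the integral of its `P` (`energy_inequality`, `exists_energy_bound`).
* Let `M(R)` be the mean of `u` over the annulus `R/2 ≤ |x| ≤ R`, with a suitable radial weight. By
  Jensen's inequality and the bound for `P`, `e^{2M(R)} ≤ C R^{p-2}`
  (`exists_integral_radialWeight_mul_exp_le`). Since `u` is superharmonic near infinity, `M(R)` is
  bounded above (`exists_integral_radialWeight_mul_le`). Hence `e^{M(R)} ≤ C R^{σ-1}` with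
  `σ = min 1 (p/2)`.
* On the annulus, `e^{nv}` is controlled in the mean by `e^{nM(R)}` (`exists_local_bound`). Indeed
  `v(x)` is an average of `v` at unit scale around `x`, up to a truncated logarithmic potential of
  `(-Δ)^m v`. The average differs from `M(R)` by a bounded amount because of the energy bound
  (`abs_weightedAverage_sub_weightedAverage_le`), and the exponential of the potential is integrable
  because `(-Δ)^m v` has small mass on the annulus, `f` being integrable
  (`exp_logPotential_le`, `integral_potential_annulus_le`).

The representation of `v(x)` (`integral_reprWeight_mul`) does not go through the fundamental solution:
with a radial cutoff `ψ` and the weight `χ` given by `z χ(z) = -∇(-Δ)^{m-1}ψ(z)`, the function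
`t ↦ ∫ χ(z) v(x + t z) dz` has derivative `-t^{n-1} ∫ ((-Δ)^m v)(x + t z) ψ(z) dz`, and integrating
from `0` to `1` recovers `v(x) ∫ χ`. That `∫ χ ≠ 0` follows from a recursion for the moments of
radial profiles (`moment_radialNegLap`).

The annuli therefore have volume `O(R^{nσ})`, the balls have volume `O(r^{nσ+ε})` for every `ε > 0`,
and the entropy is at most `σ`.
-/

open MeasureTheory Set Filter Topology

/-! ### Partial derivatives, the Laplacian and integration by parts -/

section Calculus

variable {n : ℕ}

/-- The positive Laplacian `-Δ`, as an operator on functions. -/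
noncomputable def negLap (f : EuclSp n → ℝ) (y : EuclSp n) : ℝ := -Laplacian.laplacian f y

/-- The squared length `∑ᵢ (∂ᵢ f)²` of the Euclidean gradient. -/
noncomputable def gradSq (f : EuclSp n → ℝ) (x : EuclSp n) : ℝ := ∑ i, partialD i f x ^ 2

lemma gradSq_nonneg (f : EuclSp n → ℝ) (x : EuclSp n) : 0 ≤ gradSq f x :=
  Finset.sum_nonneg fun _ _ => sq_nonneg _

lemma ContDiff.partialD {f : EuclSp n → ℝ} (hf : ContDiff ℝ ∞ f) (i : Fin n) :
    ContDiff ℝ ∞ (partialD i f) :=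
  (hf.fderiv_right (m := ∞) (by simp)).clm_apply contDiff_const

lemma HasCompactSupport.partialD {f : EuclSp n → ℝ} (hf : HasCompactSupport f) (i : Fin n) :
    HasCompactSupport (partialD i f) :=
  hf.fderiv_apply (𝕜 := ℝ) _

lemma continuous_gradSq {f : EuclSp n → ℝ} (hf : ContDiff ℝ ∞ f) : Continuous (gradSq f) :=
  continuous_finsetSum _ fun i _ => (hf.partialD i).continuous.pow 2

lemma negLap_eq_sum {f : EuclSp n → ℝ} (hf : ContDiff ℝ ∞ f) :
    negLap f = fun x => -∑ i, partialD i (partialD i f) x := by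
  ext x
  rw [negLap, InnerProductSpace.laplacian_eq_iteratedFDeriv_orthonormalBasis f
    (EuclideanSpace.basisFun (Fin n) ℝ)]
  congr 1
  refine Finset.sum_congr rfl fun i _ => ?_
  rw [iteratedFDeriv_two_apply]
  have hd : DifferentiableAt ℝ (fderiv ℝ f) x :=
    (hf.fderiv_right (m := ∞) (by simp)).differentiable (by simp) x
  have : partialD i f = fun y => fderiv ℝ f y (EuclideanSpace.single i 1) := rfl
  rw [this, partialD, fderiv_clm_apply hd (by fun_prop)]
  simp

lemma ContDiff.negLap {f : EuclSp n → ℝ} (hf : ContDiff ℝ ∞ f) : ContDiff ℝ ∞ (negLap f) := by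
  rw [negLap_eq_sum hf]
  exact (ContDiff.sum fun i _ => (hf.partialD i).partialD i).neg

lemma ContDiff.iterate_negLap {f : EuclSp n → ℝ} (hf : ContDiff ℝ ∞ f) (k : ℕ) :
    ContDiff ℝ ∞ (_root_.negLap^[k] f) := by
  induction k generalizing f with
  | zero => exact hf
  | succ k ih => exact ih hf.negLap

lemma hasCompactSupport_negLap {f : EuclSp n → ℝ}
    (hc : HasCompactSupport f) : HasCompactSupport (negLap f) := by
  have : tsupport (negLap f) ⊆ tsupport f := by
    apply closure_minimal _ (isClosed_tsupport f)
    intro x hx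
    by_contra h
    apply hx
    have h0 : f =ᶠ[𝓝 x] fun _ => 0 := notMem_tsupport_iff_eventuallyEq.mp h
    have := InnerProductSpace.laplacian_congr_nhds h0
    rw [negLap, this.self_of_nhds]
    simp
  exact hc.of_isClosed_subset (isClosed_tsupport _) this

lemma hasCompactSupport_iterate_negLap {f : EuclSp n → ℝ} (hf : ContDiff ℝ ∞ f)
    (hc : HasCompactSupport f) (k : ℕ) : HasCompactSupport (negLap^[k] f) := by
  induction k generalizing f with
  | zero => exact hc
  | succ k ih => exact ih hf.negLap (hasCompactSupport_negLap hc)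

lemma integral_mul_partialD {f g : EuclSp n → ℝ} (hf : ContDiff ℝ ∞ f) (hg : ContDiff ℝ ∞ g)
    (hc : HasCompactSupport g) (i : Fin n) :
    ∫ x, f x * partialD i g x = -∫ x, partialD i f x * g x := by
  refine integral_mul_fderiv_eq_neg_fderiv_mul_of_integrable ?_ ?_ ?_ ?_ ?_
  · exact ((hf.partialD i).continuous.mul hg.continuous).integrable_of_hasCompactSupport
      hc.mul_left
  · exact (hf.continuous.mul (hg.partialD i).continuous).integrable_of_hasCompactSupport
      (hc.partialD i).mul_left
  · exact (hf.continuous.mul hg.continuous).integrable_of_hasCompactSupport hc.mul_left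
  · exact fun x _ => hf.differentiable (by simp) x
  · exact fun x _ => hg.differentiable (by simp) x

lemma integral_partialD_mul_partialD {f g : EuclSp n → ℝ} (hf : ContDiff ℝ ∞ f)
    (hg : ContDiff ℝ ∞ g) (hc : HasCompactSupport g) :
    ∫ x, ∑ i, partialD i f x * partialD i g x = ∫ x, negLap f x * g x := by
  rw [integral_finsetSum]
  · simp_rw [integral_mul_partialD (hf.partialD _) hg hc]
    rw [Finset.sum_neg_distrib, ← integral_finsetSum, ← integral_neg, negLap_eq_sum hf]
    · simp [Finset.sum_mul]
    · intro i _
      exact (((hf.partialD i).partialD i).continuous.mul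
        hg.continuous).integrable_of_hasCompactSupport hc.mul_left
  · intro i _
    exact ((hf.partialD i).continuous.mul (hg.partialD i).continuous).integrable_of_hasCompactSupport
      (hc.partialD i).mul_left

lemma integral_mul_negLap {f g : EuclSp n → ℝ} (hf : ContDiff ℝ ∞ f)
    (hg : ContDiff ℝ ∞ g) (hc : HasCompactSupport g) :
    ∫ x, f x * negLap g x = ∫ x, negLap f x * g x := by
  rw [← integral_partialD_mul_partialD hf hg hc, integral_finsetSum, negLap_eq_sum hg]
  · have h : ∀ i, ∫ x, partialD i f x * partialD i g x =
        -∫ x, f x * partialD i (partialD i g) x := fun i => by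
      rw [integral_mul_partialD hf (hg.partialD i) (hc.partialD i), neg_neg]
    simp_rw [h]
    rw [Finset.sum_neg_distrib, ← integral_finsetSum, ← integral_neg]
    · simp [Finset.mul_sum]
    · intro i _
      exact (hf.continuous.mul ((hg.partialD i).partialD i).continuous).integrable_of_hasCompactSupport
        ((hc.partialD i).partialD i).mul_left
  · intro i _
    exact ((hf.partialD i).continuous.mul (hg.partialD i).continuous).integrable_of_hasCompactSupport
      (hc.partialD i).mul_left

lemma integral_mul_iterate_negLap {f g : EuclSp n → ℝ} (hf : ContDiff ℝ ∞ f)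
    (hg : ContDiff ℝ ∞ g) (hc : HasCompactSupport g) (k : ℕ) :
    ∫ x, f x * negLap^[k] g x = ∫ x, negLap^[k] f x * g x := by
  induction k generalizing f with
  | zero => rfl
  | succ k ih =>
    rw [Function.iterate_succ_apply', Function.iterate_succ_apply, ← ih hf.negLap,
      integral_mul_negLap hf (hg.iterate_negLap k) (hasCompactSupport_iterate_negLap hg hc k)]

lemma contDiff_comp_affine {f : EuclSp n → ℝ} (hf : ContDiff ℝ ∞ f) (x : EuclSp n) (t : ℝ) :
    ContDiff ℝ ∞ (fun z => f (x + t • z)) :=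
  hf.comp (contDiff_const.add (contDiff_id.const_smul t))

lemma hasFDerivAt_affine (x : EuclSp n) (t : ℝ) (z : EuclSp n) :
    HasFDerivAt (fun z : EuclSp n => x + t • z) (t • ContinuousLinearMap.id ℝ (EuclSp n)) z :=
  ((hasFDerivAt_id z).const_smul t).const_add x

lemma partialD_comp_affine {f : EuclSp n → ℝ} (hf : ContDiff ℝ ∞ f) (x : EuclSp n) (t : ℝ)
    (i : Fin n) :
    partialD i (fun z => f (x + t • z)) = fun z => t * partialD i f (x + t • z) := by
  ext z
  have h := ((hf.differentiable (by simp) (x + t • z)).hasFDerivAt.comp z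
    (hasFDerivAt_affine x t z)).fderiv
  have h' : fderiv ℝ (fun z => f (x + t • z)) z = _ := h
  rw [partialD, h', partialD]
  simp

lemma negLap_comp_affine {f : EuclSp n → ℝ} (hf : ContDiff ℝ ∞ f) (x : EuclSp n) (t : ℝ) :
    negLap (fun z => f (x + t • z)) = fun z => t ^ 2 * negLap f (x + t • z) := by
  have hmul : ∀ (i : Fin n) (h : EuclSp n → ℝ), ContDiff ℝ ∞ h →
      partialD i (fun z => t * h z) = fun z => t * partialD i h z := by
    intro i h hh
    ext z
    rw [partialD, fderiv_const_mul (hh.differentiable (by simp) z)]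
    rfl
  rw [negLap_eq_sum (contDiff_comp_affine hf x t), negLap_eq_sum hf]
  ext z
  have : ∀ i, partialD i (partialD i fun z => f (x + t • z)) z =
      t ^ 2 * partialD i (partialD i f) (x + t • z) := fun i => by
    rw [partialD_comp_affine hf, hmul i _ (contDiff_comp_affine (hf.partialD i) x t),
      partialD_comp_affine (hf.partialD i)]
    ring
  simp_rw [this]
  rw [← Finset.mul_sum]
  ring

lemma negLap_const_mul (c : ℝ) {f : EuclSp n → ℝ} (hf : ContDiff ℝ ∞ f) :
    negLap (fun z => c * f z) = fun z => c * negLap f z := by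
  ext z
  have := InnerProductSpace.laplacian_smul (x := z) c (by exact_mod_cast (contDiff_infty.mp hf 2).contDiffAt)
  have h2 : (c • f) = fun z => c * f z := rfl
  rw [negLap, ← h2, this, negLap]
  simp

lemma iterate_negLap_comp_affine {f : EuclSp n → ℝ} (hf : ContDiff ℝ ∞ f) (x : EuclSp n) (t : ℝ)
    (k : ℕ) :
    negLap^[k] (fun z => f (x + t • z)) = fun z => t ^ (2 * k) * negLap^[k] f (x + t • z) := by
  induction k with
  | zero => simp
  | succ k ih =>
    rw [Function.iterate_succ_apply', ih,
      negLap_const_mul _ (contDiff_comp_affine (hf.iterate_negLap k) x t),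
      negLap_comp_affine (hf.iterate_negLap k), Function.iterate_succ_apply']
    ext z
    ring

lemma gradSq_comp_affine {f : EuclSp n → ℝ} (hf : ContDiff ℝ ∞ f) (x : EuclSp n) (t : ℝ) :
    gradSq (fun z => f (x + t • z)) = fun z => t ^ 2 * gradSq f (x + t • z) := by
  ext z
  simp only [gradSq, partialD_comp_affine hf, Finset.mul_sum, mul_pow]

lemma fderiv_apply_eq_sum (f : EuclSp n → ℝ) (x v : EuclSp n) :
    fderiv ℝ f x v = ∑ i, v i * partialD i f x := by
  conv_lhs => rw [← (EuclideanSpace.basisFun (Fin n) ℝ).sum_repr v]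
  simp [partialD]

lemma abs_fderiv_apply_le (f : EuclSp n → ℝ) (x v : EuclSp n) :
    |fderiv ℝ f x v| ≤ ‖v‖ * √(gradSq f x) := by
  rw [fderiv_apply_eq_sum, ← Real.sqrt_sq_eq_abs, EuclideanSpace.norm_eq, ← Real.sqrt_mul (by positivity)]
  refine Real.sqrt_le_sqrt ?_
  simpa [gradSq] using Finset.sum_mul_sq_le_sq_mul_sq Finset.univ (fun i => v i) (fun i => partialD i f x)

/-- Differentiation under the integral sign against a compactly supported weight. -/
lemma hasDerivAt_integral_mul {K : EuclSp n → ℝ} (hK : Continuous K) (hc : HasCompactSupport K)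
    {Φ Φ' : ℝ → EuclSp n → ℝ} (hΦ : ∀ t, Continuous (Φ t))
    (hΦ' : Continuous (fun q : ℝ × EuclSp n => Φ' q.1 q.2))
    (hd : ∀ t z, HasDerivAt (fun s => Φ s z) (Φ' t z) t) (t : ℝ) :
    HasDerivAt (fun s => ∫ z, K z * Φ s z) (∫ z, K z * Φ' t z) t := by
  obtain ⟨B, hB⟩ := ((isCompact_closedBall t 1).prod hc.isCompact).exists_bound_of_continuousOn
    hΦ'.continuousOn
  refine (hasDerivAt_integral_of_dominated_loc_of_deriv_le (F' := fun s z => K z * Φ' s z)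
    (bound := fun z => |K z| * B) (Metric.closedBall_mem_nhds t one_pos)
    ?_ ?_ ?_ ?_ ?_ ?_).2
  · exact Eventually.of_forall fun s => (hK.mul (hΦ s)).aestronglyMeasurable
  · exact (hK.mul (hΦ t)).integrable_of_hasCompactSupport hc.mul_right
  · exact (hK.mul (hΦ'.comp (Continuous.prodMk continuous_const continuous_id))).aestronglyMeasurable
  · refine Eventually.of_forall fun z s hs => ?_
    by_cases hz : z ∈ tsupport K
    · rw [norm_mul, Real.norm_eq_abs]
      exact mul_le_mul_of_nonneg_left (hB (s, z) ⟨hs, hz⟩) (abs_nonneg _)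
    · simp [image_eq_zero_of_notMem_tsupport hz]
  · exact (hK.abs.mul continuous_const).integrable_of_hasCompactSupport
      (hc.norm.mul_right (f' := fun _ => B))
  · exact Eventually.of_forall fun z s _ => (hd s z).const_mul _

end Calculus

/-! ### Curvature and volume of a conformally flat metric -/

section Curvature

variable {n : ℕ}

lemma inv_exp_smul_one (a : ℝ) :
    (Real.exp a • (1 : Matrix (Fin n) (Fin n) ℝ))⁻¹ = Real.exp (-a) • 1 := by
  refine Matrix.inv_eq_right_inv ?_
  rw [smul_mul_smul_comm, ← Real.exp_add]
  simp

lemma partialD_ite_exp {u : EuclSp n → ℝ} (hu : ContDiff ℝ ∞ u) (i j l : Fin n) (x : EuclSp n) :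
    partialD i (fun y => conformalMetric u y j l) x =
      if j = l then 2 * partialD i u x * Real.exp (2 * u x) else 0 := by
  have hd : DifferentiableAt ℝ u x := hu.differentiable (by simp) x
  by_cases h : j = l
  · subst h
    have : (fun y => conformalMetric u y j j) = fun y => Real.exp (2 * u y) := by
      ext y; simp [conformalMetric]
    rw [this, partialD, fderiv_exp (hd.const_mul 2), fderiv_const_mul hd]
    simp [partialD]
    ring
  · have : (fun y => conformalMetric u y j l) = fun y => 0 := by
      ext y; simp [conformalMetric, h]
    rw [this]
    simp [partialD, h]

/-- `Γ^k_{ij} = δ_{jk} ∂ᵢu + δ_{ik} ∂ⱼu - δ_{ij} ∂ₖu` for the metric `e^{2u}|dx|²`. -/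
lemma christoffel_conformalMetric {u : EuclSp n → ℝ} (hu : ContDiff ℝ ∞ u) (k i j : Fin n) :
    (conformalMetric u).christoffel k i j = fun x =>
      (if j = k then (1 : ℝ) else 0) * partialD i u x + (if i = k then (1 : ℝ) else 0) * partialD j u x
        - (if i = j then (1 : ℝ) else 0) * partialD k u x := by
  ext x
  rw [MetricField.christoffel]
  simp_rw [partialD_ite_exp hu]
  rw [conformalMetric, inv_exp_smul_one, Finset.sum_eq_single k]
  · have h : Real.exp (-(2 * u x)) * Real.exp (2 * u x) = 1 := by
      rw [← Real.exp_add]; simp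
    simp only [Matrix.smul_apply, Matrix.one_apply_eq, smul_eq_mul, mul_one]
    have hs : ∀ (q : Prop) [Decidable q] (a : ℝ), (if q then a else 0) = (if q then (1 : ℝ) else 0) * a :=
      fun q _ a => by split_ifs <;> simp
    rw [hs (j = k), hs (i = k), hs (i = j)]
    linear_combination ((if j = k then (1 : ℝ) else 0) * partialD i u x
      + (if i = k then (1 : ℝ) else 0) * partialD j u x
      - (if i = j then (1 : ℝ) else 0) * partialD k u x) * h
  · intro l _ hl
    simp [Matrix.one_apply_ne (Ne.symm hl)]
  · simp

lemma partialD_christoffel_conformalMetric {u : EuclSp n → ℝ} (hu : ContDiff ℝ ∞ u)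
    (k i j l : Fin n) (x : EuclSp n) :
    partialD l ((conformalMetric u).christoffel k i j) x =
      (if j = k then (1 : ℝ) else 0) * partialD l (partialD i u) x
        + (if i = k then (1 : ℝ) else 0) * partialD l (partialD j u) x
        - (if i = j then (1 : ℝ) else 0) * partialD l (partialD k u) x := by
  have hd : ∀ a, DifferentiableAt ℝ (partialD a u) x :=
    fun a => (hu.partialD a).differentiable (by simp) x
  rw [christoffel_conformalMetric hu, partialD,
    fderiv_fun_sub (((hd i).const_mul _).fun_add ((hd j).const_mul _)) ((hd k).const_mul _),
    fderiv_fun_add ((hd i).const_mul _) ((hd j).const_mul _),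
    fderiv_const_mul (hd i), fderiv_const_mul (hd j), fderiv_const_mul (hd k)]
  rfl

lemma sum_ricci_conformalMetric {u : EuclSp n → ℝ} (hu : ContDiff ℝ ∞ u) (x : EuclSp n) :
    ∑ i, (conformalMetric u).ricci i i x =
      (n - 1) * (2 * negLap u x - (n - 2) * gradSq u x) := by
  have h1 : ∀ i, (∑ k, (partialD k ((conformalMetric u).christoffel k i i) x
      - partialD i ((conformalMetric u).christoffel k i k) x)) =
      (2 - n) * partialD i (partialD i u) x - ∑ k, partialD k (partialD k u) x := by
    intro i
    simp only [partialD_christoffel_conformalMetric hu]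
    simp only [ite_mul, one_mul, zero_mul, Finset.sum_sub_distrib, Finset.sum_add_distrib,
      Finset.sum_ite_eq, Finset.mem_univ, if_true, Finset.sum_const, Finset.card_univ,
      Fintype.card_fin, nsmul_eq_mul]
    ring
  have h2 : ∀ i, (∑ k, ∑ l, ((conformalMetric u).christoffel k k l x *
      (conformalMetric u).christoffel l i i x - (conformalMetric u).christoffel k i l x *
      (conformalMetric u).christoffel l i k x)) =
      (n - 2) * partialD i u x ^ 2 + (2 - n) * gradSq u x := by
    intro i
    have h3 : ∀ k l, (conformalMetric u).christoffel k k l x *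
      (conformalMetric u).christoffel l i i x - (conformalMetric u).christoffel k i l x *
      (conformalMetric u).christoffel l i k x =
      2 * (if i = l then partialD l u x * partialD i u x else 0) - partialD l u x ^ 2
      - (if k = l then partialD i u x ^ 2 else 0)
      + (if i = k then partialD l u x ^ 2 else 0)
      + (if i = l then partialD k u x ^ 2 else 0)
      - 2 * (if i = k then (if k = l then partialD i u x ^ 2 else 0) else 0) := by
      intro k l
      simp only [christoffel_conformalMetric hu]
      by_cases hkl : k = l
      · subst hkl
        by_cases hik : i = k
        · subst hik; simp; ring
        · simp [hik]; ring
      · have hlk : ¬ l = k := fun h => hkl h.symm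
        by_cases hik : i = k
        · subst hik; simp [hkl, hlk]
        · by_cases hil : i = l
          · subst hil; simp [hik, Ne.symm hik]; ring
          · simp [hik, hkl, hlk, hil]; ring
    simp_rw [h3]
    simp only [Finset.sum_sub_distrib, Finset.sum_add_distrib, ← Finset.mul_sum,
      Finset.sum_ite_eq, Finset.mem_univ, if_true, Finset.sum_const, Finset.card_univ,
      Fintype.card_fin, nsmul_eq_mul, gradSq]
    have : ∑ a : Fin n, ∑ b : Fin n, (if i = a then partialD b u x ^ 2 else 0) =
        ∑ b, partialD b u x ^ 2 := by
      rw [Finset.sum_comm]; simp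
    rw [this]
    have : ∑ a : Fin n, ∑ b : Fin n, (if i = a then (if a = b then partialD i u x ^ 2 else 0) else 0) =
        partialD i u x ^ 2 := by
      rw [Finset.sum_comm]; simp
    rw [this]
    ring
  simp_rw [MetricField.ricci, h1, h2]
  rw [negLap_eq_sum hu]
  simp only [Finset.sum_sub_distrib, Finset.sum_add_distrib, ← Finset.mul_sum,
      Finset.sum_const, Finset.card_univ, Fintype.card_fin, nsmul_eq_mul]
  rw [← gradSq]
  ring

/-- The scalar curvature of `e^{2u}|dx|²` is `(n-1) e^{-2u} (-2Δu - (n-2)|∇u|²)`. -/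
lemma scalarCurvature_conformalMetric {u : EuclSp n → ℝ} (hu : ContDiff ℝ ∞ u) (x : EuclSp n) :
    (conformalMetric u).scalarCurvature x =
      (n - 1) * Real.exp (-(2 * u x)) * (2 * negLap u x - (n - 2) * gradSq u x) := by
  have h : ∀ i, ∑ j, (conformalMetric u x)⁻¹ i j * (conformalMetric u).ricci i j x =
      Real.exp (-(2 * u x)) * (conformalMetric u).ricci i i x := by
    intro i
    rw [conformalMetric, inv_exp_smul_one, Finset.sum_eq_single i]
    · simp
    · intro j _ hj
      simp [Matrix.one_apply_ne (Ne.symm hj)]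
    · simp
  rw [MetricField.scalarCurvature]
  simp_rw [h]
  rw [← Finset.mul_sum, sum_ricci_conformalMetric hu]
  ring

lemma volumeMeasure_conformalMetric (u : EuclSp n → ℝ) :
    (conformalMetric u).volumeMeasure =
      volume.withDensity fun x => ENNReal.ofReal (Real.exp (n * u x)) := by
  rw [MetricField.volumeMeasure]
  congr 1
  ext x
  rw [conformalMetric, Matrix.det_smul, Matrix.det_one, mul_one, Fintype.card_fin,
    ← Real.exp_nat_mul, show (n : ℝ) * (2 * u x) = n * u x + n * u x by ring, Real.exp_add,
    Real.sqrt_mul_self (Real.exp_pos _).le]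

end Curvature

/-! ### The energy estimate -/

section Energy

variable {n : ℕ}

/-- The function `-2Δu - (n-2)|∇u|²`, which is `e^{2u} R_g / (n-1)` for `g = e^{2u}|dx|²`. -/
noncomputable def scalarPart (u : EuclSp n → ℝ) (x : EuclSp n) : ℝ :=
  2 * negLap u x - (n - 2) * gradSq u x

lemma continuous_scalarPart {u : EuclSp n → ℝ} (hu : ContDiff ℝ ∞ u) :
    Continuous (scalarPart u) :=
  (continuous_const.mul hu.negLap.continuous).sub
    (continuous_const.mul (continuous_gradSq hu))

lemma partialD_sq {η : EuclSp n → ℝ} (hη : ContDiff ℝ ∞ η) (i : Fin n) (x : EuclSp n) :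
    partialD i (fun z => η z ^ 2) x = 2 * η x * partialD i η x := by
  rw [partialD, fderiv_fun_pow 2 (hη.differentiable (by simp) x)]
  simp [partialD]

/-- Testing `-2Δv - (n-2)|∇v|²` with `η²` and absorbing the cross term by Young's inequality. -/
lemma energy_inequality {v η : EuclSp n → ℝ} (hv : ContDiff ℝ ∞ v) (hη : ContDiff ℝ ∞ η)
    (hc : HasCompactSupport η) :
    (n - 3) * (∫ z, η z ^ 2 * gradSq v z) + ∫ z, η z ^ 2 * scalarPart v z ≤
      4 * ∫ z, gradSq η z := by
  have hη2 : ContDiff ℝ ∞ (fun z => η z ^ 2) := hη.pow 2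
  have hc2 : HasCompactSupport (fun z => η z ^ 2) := hc.comp_left (g := fun a => a ^ 2) (by simp)
  have i1 : Integrable (fun z => η z ^ 2 * gradSq v z) :=
    (hη2.continuous.mul (continuous_gradSq hv)).integrable_of_hasCompactSupport hc2.mul_right
  have i2 : Integrable (fun z => negLap v z * η z ^ 2) :=
    (hv.negLap.continuous.mul hη2.continuous).integrable_of_hasCompactSupport hc2.mul_left
  have hcg : HasCompactSupport (gradSq η) := by
    refine hc.of_isClosed_subset (isClosed_tsupport _) (closure_minimal ?_ (isClosed_tsupport η))
    intro z hz
    by_contra h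
    refine hz (Finset.sum_eq_zero fun i _ => ?_)
    have := (fderiv_of_notMem_tsupport (𝕜 := ℝ) h)
    simp [partialD, this]
  have i3 : Integrable (gradSq η) := (continuous_gradSq hη).integrable_of_hasCompactSupport hcg
  have h1 : ∫ z, η z ^ 2 * scalarPart v z =
      2 * (∫ z, negLap v z * η z ^ 2) - (n - 2) * ∫ z, η z ^ 2 * gradSq v z := by
    rw [← integral_const_mul, ← integral_const_mul, ← integral_sub (i2.const_mul _) (i1.const_mul _)]
    congr 1
    ext z
    rw [scalarPart]
    ring
  have h2 : 2 * ∫ z, negLap v z * η z ^ 2 ≤ 4 * (∫ z, gradSq η z) + ∫ z, η z ^ 2 * gradSq v z := by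
    rw [← integral_partialD_mul_partialD hv hη2 hc2, ← integral_const_mul, ← integral_const_mul,
      ← integral_add (i3.const_mul _) i1]
    refine integral_mono ?_ ((i3.const_mul _).add i1) fun z => ?_
    · refine (Integrable.const_mul (integrable_finsetSum _ fun i _ => ?_) _)
      exact ((hv.partialD i).continuous.mul
        (hη2.partialD i).continuous).integrable_of_hasCompactSupport (hc2.partialD i).mul_left
    · simp only [gradSq, Finset.mul_sum]
      rw [← Finset.sum_add_distrib]
      refine Finset.sum_le_sum fun i _ => ?_
      rw [partialD_sq hη]
      -- Young's inequality `4ab ≤ 4a² + b²` with `a = ∂ᵢη` and `b = η ∂ᵢv`.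
      nlinarith [sq_nonneg (2 * partialD i η z - η z * partialD i v z)]
  rw [h1]
  linarith

lemma contDiff_comp_smul {f : EuclSp n → ℝ} (hf : ContDiff ℝ ∞ f) (R : ℝ) :
    ContDiff ℝ ∞ (fun z => f (R • z)) := hf.comp (contDiff_id.const_smul R)

lemma gradSq_comp_smul {u : EuclSp n → ℝ} (hu : ContDiff ℝ ∞ u) (R : ℝ) (z : EuclSp n) :
    gradSq (fun z => u (R • z)) z = R ^ 2 * gradSq u (R • z) := by
  simpa using congrFun (gradSq_comp_affine hu 0 R) z

lemma iterate_negLap_comp_smul {u : EuclSp n → ℝ} (hu : ContDiff ℝ ∞ u) (R : ℝ) (k : ℕ)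
    (z : EuclSp n) :
    negLap^[k] (fun z => u (R • z)) z = R ^ (2 * k) * negLap^[k] u (R • z) := by
  simpa using congrFun (iterate_negLap_comp_affine hu 0 R k) z

lemma scalarPart_comp_smul {u : EuclSp n → ℝ} (hu : ContDiff ℝ ∞ u) (R : ℝ) (z : EuclSp n) :
    scalarPart (fun z => u (R • z)) z = R ^ 2 * scalarPart u (R • z) := by
  have := iterate_negLap_comp_smul hu R 1 z
  simp only [Function.iterate_one, mul_one] at this
  rw [scalarPart, this, gradSq_comp_smul hu, scalarPart]
  ring

/-- If `-2Δu - (n-2)|∇u|²` is nonnegative outside a ball, then the Dirichlet energy of the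
rescalings `u(R ·)` on a fixed region is bounded uniformly in `R`, and so is the integral of
`-2Δ - (n-2)|∇·|²` over the part of that region which corresponds to the complement of the ball. -/
lemma exists_energy_bound (hn : 4 ≤ n) {u η : EuclSp n → ℝ} (hu : ContDiff ℝ ∞ u)
    (hη : ContDiff ℝ ∞ η) (hc : HasCompactSupport η) (hη1 : ∀ z, η z ^ 2 ≤ 1) {R₀ : ℝ}
    (hP : ∀ x, R₀ < ‖x‖ → 0 ≤ scalarPart u x) :
    ∃ C : ℝ, ∀ R : ℝ, 1 ≤ R →
      ∫ z, η z ^ 2 * gradSq (fun z => u (R • z)) z ≤ C ∧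
      ∫ z, {z : EuclSp n | R₀ < ‖R • z‖}.indicator
        (fun z => η z ^ 2 * scalarPart (fun z => u (R • z)) z) z ≤ C := by
  set φ : EuclSp n → ℝ := (Metric.closedBall 0 R₀).indicator fun x => |scalarPart u x| with hφ
  have hφ0 : ∀ x, 0 ≤ φ x := fun x => indicator_nonneg (fun _ _ => abs_nonneg _) x
  have iφ : Integrable φ := by
    rw [hφ, integrable_indicator_iff measurableSet_closedBall]
    exact (continuous_scalarPart hu).abs.continuousOn.integrableOn_compact
      (isCompact_closedBall 0 R₀)
  -- Rescaling multiplies the integral of `φ` by `R^{2-n} ≤ 1`, so the bound is uniform in `R ≥ 1`.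
  refine ⟨4 * (∫ z, gradSq η z) + ∫ x, φ x, fun R hR => ?_⟩
  have hR0 : 0 < R := by linarith
  set v : EuclSp n → ℝ := fun z => u (R • z) with hvdef
  have hv : ContDiff ℝ ∞ v := contDiff_comp_smul hu R
  set S : Set (EuclSp n) := {z | R₀ < ‖R • z‖} with hS
  have hSm : MeasurableSet S :=
    measurableSet_lt measurable_const (continuous_const_smul R).norm.measurable
  have hc2 : HasCompactSupport (fun z => η z ^ 2) := hc.comp_left (g := fun a => a ^ 2) (by simp)
  have iP : Integrable (fun z => η z ^ 2 * scalarPart v z) :=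
    ((hη.continuous.pow 2).mul (continuous_scalarPart hv)).integrable_of_hasCompactSupport
      hc2.mul_right
  have iφR : Integrable (fun z => φ (R • z)) := iφ.comp_smul hR0.ne'
  have hφR : R ^ 2 * ∫ z, φ (R • z) ≤ ∫ x, φ x := by
    rw [Measure.integral_comp_smul, finrank_euclideanSpace_fin, smul_eq_mul, ← mul_assoc]
    refine mul_le_of_le_one_left (integral_nonneg hφ0) ?_
    rw [abs_of_nonneg (by positivity), ← div_eq_mul_inv, div_le_one (by positivity)]
    exact pow_le_pow_right₀ hR (by omega)
  have hpt : ∀ z, S.indicator (fun z => η z ^ 2 * scalarPart v z) z ≤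
      η z ^ 2 * scalarPart v z + R ^ 2 * φ (R • z) := by
    intro z
    by_cases hz : z ∈ S
    · rw [indicator_of_mem hz]
      have := hφ0 (R • z)
      nlinarith [sq_nonneg R]
    · rw [indicator_of_notMem hz]
      have hz' : R • z ∈ Metric.closedBall (0 : EuclSp n) R₀ := by
        simpa [hS, not_lt] using hz
      rw [hφ, indicator_of_mem hz', hvdef, scalarPart_comp_smul hu]
      have h1 := neg_abs_le (scalarPart u (R • z))
      have h2 := abs_nonneg (scalarPart u (R • z))
      have h3 : 0 ≤ R ^ 2 * ((1 - η z ^ 2) * |scalarPart u (R • z)| +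
          η z ^ 2 * (|scalarPart u (R • z)| + scalarPart u (R • z))) := by
        have := hη1 z
        exact mul_nonneg (sq_nonneg _) (add_nonneg (mul_nonneg (by linarith) h2)
          (mul_nonneg (sq_nonneg _) (by linarith)))
      linarith
  have h1 := integral_mono (iP.indicator hSm) (iP.add (iφR.const_mul _)) hpt
  simp only [Pi.add_apply] at h1
  rw [integral_add iP (iφR.const_mul _), integral_const_mul] at h1
  have h2 := energy_inequality hv hη hc
  have h3 : 0 ≤ ∫ z, η z ^ 2 * gradSq v z :=
    integral_nonneg fun z => mul_nonneg (sq_nonneg _) (gradSq_nonneg _ _)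
  have h4 : 0 ≤ ∫ z, S.indicator (fun z => η z ^ 2 * scalarPart v z) z := by
    refine integral_nonneg fun z => indicator_nonneg (fun z hz => ?_) z
    rw [hvdef, scalarPart_comp_smul hu]
    exact mul_nonneg (sq_nonneg _) (mul_nonneg (sq_nonneg _) (hP _ hz))
  -- Both terms on the left of `h2` are nonnegative up to `φ`, and `n ≥ 4` keeps the first one.
  have h5 : (1 : ℝ) ≤ n - 3 := by
    have : (4 : ℝ) ≤ n := by exact_mod_cast hn
    linarith
  constructor <;> nlinarith

end Energy

/-! ### Averages over dilations -/

section Dilation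

variable {n : ℕ}

/-- If the weight `χ` satisfies `z χ(z) = -∇ψ(z)`, then the derivative of the averages
`t ↦ ∫ χ(z) v(x + t z) dz` is an average of `Δv` with the weight `ψ`. -/
lemma hasDerivAt_dilation {v χ ψ : EuclSp n → ℝ} (hv : ContDiff ℝ ∞ v)
    (hχ : Continuous χ) (hχc : HasCompactSupport χ)
    (hψ : ContDiff ℝ ∞ ψ) (hψc : HasCompactSupport ψ)
    (h : ∀ i z, z i * χ z = -partialD i ψ z) (x : EuclSp n) (t : ℝ) :
    HasDerivAt (fun t => ∫ z, χ z * v (x + t • z)) (-t * ∫ z, negLap v (x + t • z) * ψ z) t := by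
  have hd := hasDerivAt_integral_mul hχ hχc (Φ := fun t z => v (x + t • z))
    (Φ' := fun t z => fderiv ℝ v (x + t • z) z)
    (fun t => (contDiff_comp_affine hv x t).continuous)
    ((((hv.fderiv_right (m := ∞) (by simp)).continuous).comp (by fun_prop)).clm_apply continuous_snd)
    (fun t z => by
      have h1 : HasDerivAt (fun s : ℝ => x + s • z) z t := by
        simpa using ((hasDerivAt_id t).smul_const z).const_add x
      exact (hv.differentiable (by simp) (x + t • z)).hasFDerivAt.comp_hasDerivAt t h1) t
  convert hd using 1
  have e1 : ∀ z, χ z * fderiv ℝ v (x + t • z) z =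
      -∑ i, partialD i v (x + t • z) * partialD i ψ z := by
    intro z
    rw [fderiv_apply_eq_sum, Finset.mul_sum, ← Finset.sum_neg_distrib]
    refine Finset.sum_congr rfl fun i _ => ?_
    linear_combination (partialD i v (x + t • z)) * h i z
  simp_rw [e1]
  have hw : ∀ i, ContDiff ℝ ∞ (fun z => partialD i v (x + t • z)) :=
    fun i => contDiff_comp_affine (hv.partialD i) x t
  rw [integral_neg, integral_finsetSum]
  · simp_rw [integral_mul_partialD (hw _) hψ hψc]
    rw [Finset.sum_neg_distrib, neg_neg, ← integral_finsetSum, ← integral_const_mul]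
    · congr 1
      ext z
      simp only [partialD_comp_affine (hv.partialD _), negLap_eq_sum hv]
      rw [← Finset.sum_mul, ← Finset.mul_sum]
      ring
    · intro i _
      exact (((hw i).partialD i).continuous.mul
        hψ.continuous).integrable_of_hasCompactSupport hψc.mul_left
  · intro i _
    exact ((hw i).continuous.mul (hψ.partialD i).continuous).integrable_of_hasCompactSupport
      (hψc.partialD i).mul_left

lemma hasDerivAt_dilation_iterate {v χ ψ : EuclSp n → ℝ} (hv : ContDiff ℝ ∞ v)
    (hχ : Continuous χ) (hχc : HasCompactSupport χ)
    (hψ : ContDiff ℝ ∞ ψ) (hψc : HasCompactSupport ψ) (k : ℕ)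
    (h : ∀ i z, z i * χ z = -partialD i (negLap^[k] ψ) z) (x : EuclSp n) (t : ℝ) :
    HasDerivAt (fun t => ∫ z, χ z * v (x + t • z))
      (-t ^ (2 * k + 1) * ∫ z, negLap^[k + 1] v (x + t • z) * ψ z) t := by
  convert hasDerivAt_dilation hv hχ hχc (hψ.iterate_negLap k)
    (hasCompactSupport_iterate_negLap hψ hψc k) h x t using 1
  rw [integral_mul_iterate_negLap (contDiff_comp_affine hv.negLap x t) hψ hψc k,
    iterate_negLap_comp_affine hv.negLap]
  simp_rw [mul_assoc]
  rw [integral_const_mul, Function.iterate_succ_apply]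
  ring

end Dilation

/-! ### Radial functions and moments of their weights -/

section Radial

variable {n : ℕ}

/-- The operator induced by `-Δ` on `ℝⁿ` on the profiles `G` of the functions `G(|z|²)`. -/
noncomputable def radialNegLap (n : ℕ) (G : ℝ → ℝ) (s : ℝ) : ℝ :=
  -(4 * s * deriv (deriv G) s + 2 * n * deriv G s)

/-- The weight `χ(z) = -2 G'(|z|²)`, for which `z χ(z) = -∇(G(|z|²))`. -/
noncomputable def radialWeight (n : ℕ) (G : ℝ → ℝ) (z : EuclSp n) : ℝ := -2 * deriv G (‖z‖ ^ 2)

lemma contDiff_deriv_infty {G : ℝ → ℝ} (hG : ContDiff ℝ ∞ G) : ContDiff ℝ ∞ (deriv G) :=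
  (contDiff_infty_iff_deriv.mp hG).2

lemma deriv_eq_zero_of_eq_zero_beyond {G : ℝ → ℝ} (h : ∀ s, 1 < s → G s = 0) :
    ∀ s, 1 < s → deriv G s = 0 := by
  intro s hs
  have : G =ᶠ[𝓝 s] fun _ => 0 := by
    filter_upwards [lt_mem_nhds hs] with a ha using h a ha
  rw [this.deriv_eq]
  simp

lemma contDiff_radialNegLap {G : ℝ → ℝ} (hG : ContDiff ℝ ∞ G) :
    ContDiff ℝ ∞ (radialNegLap n G) := by
  have h1 := contDiff_deriv_infty hG
  have h2 := contDiff_deriv_infty h1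
  exact (((contDiff_const.mul contDiff_id).mul h2).add (contDiff_const.mul h1)).neg

lemma radialNegLap_eq_zero_beyond {G : ℝ → ℝ} (h : ∀ s, 1 < s → G s = 0) :
    ∀ s, 1 < s → radialNegLap n G s = 0 := by
  intro s hs
  have h1 := deriv_eq_zero_of_eq_zero_beyond h
  have h2 := deriv_eq_zero_of_eq_zero_beyond h1
  simp [radialNegLap, h1 s hs, h2 s hs]

lemma contDiff_iterate_radialNegLap {G : ℝ → ℝ} (hG : ContDiff ℝ ∞ G) (k : ℕ) :
    ContDiff ℝ ∞ ((radialNegLap n)^[k] G) := by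
  induction k generalizing G with
  | zero => exact hG
  | succ k ih => exact ih (contDiff_radialNegLap hG)

lemma iterate_radialNegLap_eq_zero_beyond {G : ℝ → ℝ} (h : ∀ s, 1 < s → G s = 0) (k : ℕ) :
    ∀ s, 1 < s → (radialNegLap n)^[k] G s = 0 := by
  induction k generalizing G with
  | zero => exact h
  | succ k ih => exact ih (radialNegLap_eq_zero_beyond h)

lemma contDiff_radial {G : ℝ → ℝ} (hG : ContDiff ℝ ∞ G) :
    ContDiff ℝ ∞ (fun z : EuclSp n => G (‖z‖ ^ 2)) := hG.comp (contDiff_norm_sq ℝ)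

lemma hasCompactSupport_radial {G : ℝ → ℝ} (h : ∀ s, 1 < s → G s = 0) :
    HasCompactSupport (fun z : EuclSp n => G (‖z‖ ^ 2)) := by
  refine HasCompactSupport.intro (isCompact_closedBall 0 1) fun z hz => h _ ?_
  have : 1 < ‖z‖ := by simpa using hz
  nlinarith

lemma contDiff_radialWeight {G : ℝ → ℝ} (hG : ContDiff ℝ ∞ G) : ContDiff ℝ ∞ (radialWeight n G) :=
  contDiff_const.mul (contDiff_radial (contDiff_deriv_infty hG))

lemma hasCompactSupport_radialWeight {G : ℝ → ℝ} (h : ∀ s, 1 < s → G s = 0) :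
    HasCompactSupport (radialWeight n G) :=
  (hasCompactSupport_radial (deriv_eq_zero_of_eq_zero_beyond h)).mul_left

lemma radialWeight_eq_zero {G : ℝ → ℝ} (h : ∀ s, 1 < s → G s = 0) {z : EuclSp n}
    (hz : 1 < ‖z‖) : radialWeight n G z = 0 := by
  rw [radialWeight, deriv_eq_zero_of_eq_zero_beyond h _ (by nlinarith), mul_zero]

lemma partialD_radial {G : ℝ → ℝ} (hG : ContDiff ℝ ∞ G) (i : Fin n) (z : EuclSp n) :
    partialD i (fun z : EuclSp n => G (‖z‖ ^ 2)) z = 2 * z i * deriv G (‖z‖ ^ 2) := by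
  have h := ((hG.differentiable (by simp) (‖z‖ ^ 2)).hasDerivAt.comp_hasFDerivAt z
    (hasStrictFDerivAt_norm_sq z).hasFDerivAt).fderiv
  have h' : fderiv ℝ (fun z : EuclSp n => G (‖z‖ ^ 2)) z = _ := h
  have hi : inner ℝ z (EuclideanSpace.single i (1 : ℝ)) = z i := by
    simp [EuclideanSpace.inner_single_right]
  rw [partialD, h']
  simp [hi]
  ring

lemma mul_radialWeight {G : ℝ → ℝ} (hG : ContDiff ℝ ∞ G) (i : Fin n) (z : EuclSp n) :
    z i * radialWeight n G z = -partialD i (fun z : EuclSp n => G (‖z‖ ^ 2)) z := by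
  rw [partialD_radial hG, radialWeight]
  ring

lemma negLap_radial {G : ℝ → ℝ} (hG : ContDiff ℝ ∞ G) :
    negLap (fun z : EuclSp n => G (‖z‖ ^ 2)) = fun z => radialNegLap n G (‖z‖ ^ 2) := by
  have hG1 := contDiff_deriv_infty hG
  rw [negLap_eq_sum (contDiff_radial hG)]
  ext z
  have h : ∀ i, partialD i (partialD i fun z : EuclSp n => G (‖z‖ ^ 2)) z =
      2 * deriv G (‖z‖ ^ 2) + 4 * deriv (deriv G) (‖z‖ ^ 2) * z i ^ 2 := by
    intro i
    have e : (partialD i fun z : EuclSp n => G (‖z‖ ^ 2)) =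
        fun z => (2 * z i) * deriv G (‖z‖ ^ 2) := funext fun z => partialD_radial hG i z
    have hl : HasFDerivAt (fun z : EuclSp n => 2 * z i)
        ((2 : ℝ) • (EuclideanSpace.proj i : EuclSp n →L[ℝ] ℝ)) z :=
      ((EuclideanSpace.proj i : EuclSp n →L[ℝ] ℝ).hasFDerivAt).const_mul 2
    have hr : HasFDerivAt (fun z : EuclSp n => deriv G (‖z‖ ^ 2)) _ z :=
      ((contDiff_radial hG1).differentiable (by simp) z).hasFDerivAt
    have hp := partialD_radial hG1 i z
    rw [partialD] at hp
    rw [e, partialD, (hl.fun_mul hr).fderiv]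
    simp [hp]
    ring
  simp_rw [h]
  rw [Finset.sum_add_distrib, ← Finset.mul_sum, ← Finset.mul_sum, ← EuclideanSpace.real_norm_sq_eq, radialNegLap]
  simp
  ring

lemma iterate_negLap_radial {G : ℝ → ℝ} (hG : ContDiff ℝ ∞ G) (k : ℕ) :
    negLap^[k] (fun z : EuclSp n => G (‖z‖ ^ 2)) =
      fun z => (radialNegLap n)^[k] G (‖z‖ ^ 2) := by
  induction k generalizing G with
  | zero => rfl
  | succ k ih =>
    rw [Function.iterate_succ_apply, negLap_radial hG, ih (contDiff_radialNegLap hG),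
      Function.iterate_succ_apply]

/-- The moments `∫ s^k G'(s) ds` satisfy a two-term recursion under the radial Laplacian. The profile
vanishes beyond `1`; the upper limit `4 = 2²` anticipates the substitution `s = r²`, `r ≤ 2`. -/
lemma moment_radialNegLap {G : ℝ → ℝ} (hG : ContDiff ℝ ∞ G) (h : ∀ s, 1 < s → G s = 0) (k : ℕ) :
    ∫ s in (0 : ℝ)..4, s ^ (k + 1) * deriv (radialNegLap n G) s =
      2 * (k + 1) * (n - 2 * (k + 1)) * ∫ s in (0 : ℝ)..4, s ^ k * deriv G s := by
  have hG1 := contDiff_deriv_infty hG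
  have hG2 := contDiff_deriv_infty hG1
  have hL : ContDiff ℝ ∞ (radialNegLap n G) := contDiff_radialNegLap hG
  have hL1 := contDiff_deriv_infty hL
  have hpow : ∀ x : ℝ, HasDerivAt (fun s : ℝ => s ^ (k + 1)) ((k + 1) * x ^ k) x := fun x => by
    simpa using hasDerivAt_pow (k + 1) x
  have hcp : Continuous fun x : ℝ => (k + 1) * x ^ k := by fun_prop
  have e1 := intervalIntegral.integral_mul_deriv_eq_deriv_mul (a := 0) (b := 4)
    (u := fun s : ℝ => s ^ (k + 1)) (v := radialNegLap n G) (fun x _ => hpow x)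
    (fun x _ => (hL.differentiable (by simp) x).hasDerivAt)
    (hcp.intervalIntegrable _ _) (hL1.continuous.intervalIntegrable _ _)
  have e2 := intervalIntegral.integral_mul_deriv_eq_deriv_mul (a := 0) (b := 4)
    (u := fun s : ℝ => s ^ (k + 1)) (v := deriv G) (fun x _ => hpow x)
    (fun x _ => (hG1.differentiable (by simp) x).hasDerivAt)
    (hcp.intervalIntegrable _ _) (hG2.continuous.intervalIntegrable _ _)
  have z1 := radialNegLap_eq_zero_beyond (n := n) h 4 (by norm_num)
  have z2 := deriv_eq_zero_of_eq_zero_beyond h 4 (by norm_num)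
  simp only [z1, z2, mul_zero, ne_eq, Nat.add_eq_zero_iff, one_ne_zero, and_false,
    not_false_eq_true, zero_pow, zero_mul, sub_zero, zero_sub] at e1 e2
  have e3 : ∫ x in (0 : ℝ)..4, (k + 1) * x ^ k * deriv G x =
      (k + 1) * ∫ x in (0 : ℝ)..4, x ^ k * deriv G x := by
    rw [← intervalIntegral.integral_const_mul]
    congr 1
    ext x
    ring
  have e4 : ∫ x in (0 : ℝ)..4, (k + 1) * x ^ k * radialNegLap n G x =
      -(k + 1) * (4 * (∫ x in (0 : ℝ)..4, x ^ (k + 1) * deriv (deriv G) x) +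
        2 * n * ∫ x in (0 : ℝ)..4, x ^ k * deriv G x) := by
    have c1 : Continuous fun x : ℝ => x ^ (k + 1) * deriv (deriv G) x :=
      (continuous_pow _).mul hG2.continuous
    have c2 : Continuous fun x : ℝ => x ^ k * deriv G x := (continuous_pow _).mul hG1.continuous
    rw [← intervalIntegral.integral_const_mul, ← intervalIntegral.integral_const_mul,
      ← intervalIntegral.integral_add ((c1.const_mul 4).intervalIntegrable _ _)
        ((c2.const_mul _).intervalIntegrable _ _), ← intervalIntegral.integral_const_mul]
    congr 1
    ext x
    rw [radialNegLap]
    ring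
  rw [e1, e4, e2, e3]
  ring

/-- The recursion ends at `∫ G' = -G(0)`, and none of its factors vanishes as long as `2k < n`. -/
lemma moment_iterate_radialNegLap_ne_zero {G : ℝ → ℝ} (hG : ContDiff ℝ ∞ G)
    (h : ∀ s, 1 < s → G s = 0) (h0 : G 0 ≠ 0) (k : ℕ) (hk : 2 * k < n) :
    ∫ s in (0 : ℝ)..4, s ^ k * deriv ((radialNegLap n)^[k] G) s ≠ 0 := by
  induction k with
  | zero =>
    simp only [pow_zero, one_mul, Function.iterate_zero, id_eq]
    rw [intervalIntegral.integral_deriv_eq_sub' _ rfl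
      (fun x _ => hG.differentiable (by simp) x) (contDiff_deriv_infty hG).continuous.continuousOn,
      h 4 (by norm_num)]
    simpa using h0
  | succ k ih =>
    rw [Function.iterate_succ_apply', moment_radialNegLap (contDiff_iterate_radialNegLap hG k)
      (iterate_radialNegLap_eq_zero_beyond h k)]
    refine mul_ne_zero (mul_ne_zero (by positivity) ?_) (ih (by omega))
    have : (2 * (k + 1) : ℝ) < n := by exact_mod_cast hk
    linarith

/-- Polar coordinates and `s = r²` turn the mass of a radial weight into a moment. -/
lemma integral_radialWeight {m : ℕ} (hm : 0 < m) {G : ℝ → ℝ} (hG : ContDiff ℝ ∞ G)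
    (h : ∀ s, 1 < s → G s = 0) :
    ∫ z, radialWeight (2 * m) G z =
      -(2 * m) * volume.real (Metric.ball (0 : EuclSp (2 * m)) 1) *
        ∫ s in (0 : ℝ)..4, s ^ (m - 1) * deriv G s := by
  obtain ⟨k, rfl⟩ : ∃ k, m = k + 1 := ⟨m - 1, by omega⟩
  have hG1 := contDiff_deriv_infty hG
  have : Nontrivial (EuclSp (2 * (k + 1))) := by
    have : Nonempty (Fin (2 * (k + 1))) := ⟨⟨0, by omega⟩⟩
    infer_instance
  have e1 := integral_fun_norm_addHaar (volume : Measure (EuclSp (2 * (k + 1))))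
    (fun r => -2 * deriv G (r ^ 2))
  have e2 : ∫ y in Ioi (0 : ℝ), y ^ (2 * (k + 1) - 1) • (-2 * deriv G (y ^ 2)) =
      ∫ y in (0 : ℝ)..2, y ^ (2 * (k + 1) - 1) • (-2 * deriv G (y ^ 2)) := by
    rw [intervalIntegral.integral_of_le (by norm_num)]
    refine (setIntegral_eq_of_subset_of_forall_sdiff_eq_zero measurableSet_Ioi
      Ioc_subset_Ioi_self fun y hy => ?_)
    have : 2 < y := by
      by_contra hc
      exact hy.2 ⟨hy.1, not_lt.mp hc⟩
    rw [deriv_eq_zero_of_eq_zero_beyond h _ (by nlinarith)]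
    simp
  have e3 := intervalIntegral.integral_comp_mul_deriv (a := 0) (b := 2) (f := fun x : ℝ => x ^ 2)
    (f' := fun x => 2 * x) (g := fun s => s ^ k * deriv G s)
    (fun x _ => by simpa using hasDerivAt_pow 2 x) (by fun_prop)
    ((continuous_pow _).mul hG1.continuous)
  have e4 : ∫ y in (0 : ℝ)..2, y ^ (2 * (k + 1) - 1) • (-2 * deriv G (y ^ 2)) =
      -∫ y in (0 : ℝ)..2, ((fun s => s ^ k * deriv G s) ∘ fun x => x ^ 2) y * (2 * y) := by
    rw [← intervalIntegral.integral_neg]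
    congr 1
    ext y
    simp only [Function.comp, smul_eq_mul, show 2 * (k + 1) - 1 = 2 * k + 1 by omega]
    ring
  have : (fun z => radialWeight (2 * (k + 1)) G z) = fun z => -2 * deriv G (‖z‖ ^ 2) := rfl
  rw [this, e1, finrank_euclideanSpace_fin, e2, e4, e3]
  norm_num
  ring

/-- A smooth nonincreasing function which is `1` for `s ≤ 1/2` and `0` for `s ≥ 1`. -/
noncomputable def cutoffProfile (s : ℝ) : ℝ := Real.smoothTransition (2 * (1 - s))

lemma contDiff_cutoffProfile : ContDiff ℝ ∞ cutoffProfile :=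
  Real.smoothTransition.contDiff.comp (contDiff_const.mul (contDiff_const.sub contDiff_id))

lemma cutoffProfile_eq_zero (s : ℝ) (hs : 1 < s) : cutoffProfile s = 0 :=
  Real.smoothTransition.zero_of_nonpos (by linarith)

lemma cutoffProfile_eq_one {s : ℝ} (hs : s ≤ 1 / 2) : cutoffProfile s = 1 :=
  Real.smoothTransition.one_of_one_le (by linarith)

lemma deriv_cutoffProfile_nonpos (s : ℝ) : deriv cutoffProfile s ≤ 0 := by
  have : Antitone cutoffProfile := fun a b hab => Real.smoothTransition.monotone (by linarith)
  exact this.deriv_nonpos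

lemma deriv_cutoffProfile_eq_zero {s : ℝ} (hs : s < 1 / 2) : deriv cutoffProfile s = 0 := by
  have : cutoffProfile =ᶠ[𝓝 s] fun _ => 1 := by
    filter_upwards [gt_mem_nhds hs] with a ha using cutoffProfile_eq_one ha.le
  rw [this.deriv_eq]
  simp

lemma radialWeight_cutoffProfile_nonneg (z : EuclSp n) : 0 ≤ radialWeight n cutoffProfile z := by
  have := deriv_cutoffProfile_nonpos (‖z‖ ^ 2)
  rw [radialWeight]
  linarith

lemma radialWeight_cutoffProfile_eq_zero {z : EuclSp n} (hz : ‖z‖ ≤ 1 / 2) :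
    radialWeight n cutoffProfile z = 0 := by
  rw [radialWeight, deriv_cutoffProfile_eq_zero (by nlinarith [norm_nonneg z]), mul_zero]

lemma integral_radialWeight_cutoffProfile_pos (hn : 0 < n) :
    0 < ∫ z, radialWeight n cutoffProfile z := by
  obtain ⟨s, hs, hs'⟩ : ∃ s ∈ Ioo (0 : ℝ) 2, deriv cutoffProfile s = (0 - 1) / (2 - 0) := by
    have := exists_deriv_eq_slope cutoffProfile (a := 0) (b := 2) (by norm_num)
      contDiff_cutoffProfile.continuous.continuousOn
      (contDiff_cutoffProfile.differentiable (by simp)).differentiableOn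
    rwa [cutoffProfile_eq_zero 2 (by norm_num), cutoffProfile_eq_one (by norm_num)] at this
  refine (contDiff_radialWeight
    contDiff_cutoffProfile).continuous.integral_pos_of_hasCompactSupport_nonneg_nonzero
    (hasCompactSupport_radialWeight cutoffProfile_eq_zero) radialWeight_cutoffProfile_nonneg
    (x := EuclideanSpace.single ⟨0, hn⟩ (√s)) ?_
  have : ‖(EuclideanSpace.single ⟨0, hn⟩ (√s) : EuclSp n)‖ ^ 2 = s := by
    rw [EuclideanSpace.single, PiLp.norm_single, Real.norm_eq_abs, sq_abs, Real.sq_sqrt hs.1.le]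
  rw [radialWeight, this, hs']
  norm_num

end Radial

/-! ### Logarithmic potentials -/

section Potential

variable {n : ℕ}

/-- Jensen's inequality for the exponential and a weight of total mass at most `1`, the missing mass
being placed where the exponent vanishes. -/
lemma exp_integral_mul_le {α : Type*} [MeasurableSpace α] {μ : Measure α} {w φ : α → ℝ}
    (hw : ∀ x, 0 ≤ w x) (iw : Integrable w μ) (h1 : ∫ x, w x ∂μ ≤ 1)
    (iφ : Integrable (fun x => w x * φ x) μ) (ie : Integrable (fun x => w x * Real.exp (φ x)) μ) :
    Real.exp (∫ x, w x * φ x ∂μ) ≤ 1 + ∫ x, w x * Real.exp (φ x) ∂μ := by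
  set s := ∫ x, w x * φ x ∂μ with hs
  have h0 : 0 ≤ ∫ x, w x ∂μ := integral_nonneg hw
  -- The tangent line of `exp` at `s`, evaluated at `φ x`; `h3` is the same inequality at `0`.
  have hpt : ∀ x, Real.exp s * ((1 - s) * w x + w x * φ x) ≤ w x * Real.exp (φ x) := by
    intro x
    have e1 : Real.exp (φ x) = Real.exp s * Real.exp (φ x - s) := by
      rw [← Real.exp_add]; congr 1; ring
    have e2 := Real.add_one_le_exp (φ x - s)
    rw [e1]
    nlinarith [mul_le_mul_of_nonneg_left e2 (mul_nonneg (hw x) (Real.exp_pos s).le)]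
  have h2 := integral_mono (((iw.const_mul (1 - s)).add iφ).const_mul _) ie hpt
  simp only [Pi.add_apply] at h2
  rw [integral_const_mul, integral_add (iw.const_mul _) iφ, integral_const_mul, ← hs] at h2
  have h3 : Real.exp s * (1 - s) ≤ 1 := by
    have := Real.add_one_le_exp (-s)
    have e : Real.exp s * Real.exp (-s) = 1 := by rw [← Real.exp_add]; simp
    nlinarith [Real.exp_pos s]
  nlinarith [mul_le_mul_of_nonneg_left h3 (sub_nonneg.mpr h1)]

lemma integrableOn_norm_rpow_ball (hn : 2 ≤ n) {a : ℝ} (ha : -2 < a) :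
    IntegrableOn (fun y : EuclSp n => ‖y‖ ^ a) (Metric.ball 0 1) := by
  have : Nontrivial (EuclSp n) := by
    have : Nonempty (Fin n) := ⟨⟨0, by omega⟩⟩
    infer_instance
  rw [integrableOn_fun_norm_addHaar (volume : Measure (EuclSp n)) (f := fun r => r ^ a),
    finrank_euclideanSpace_fin]
  have h : IntegrableOn (fun y : ℝ => y ^ ((n - 1 : ℕ) + a)) (Ioo 0 1) := by
    refine (intervalIntegral.integrableOn_Ioo_rpow_iff one_pos).mpr ?_
    have : (1 : ℝ) ≤ (n - 1 : ℕ) := by exact_mod_cast (by omega : 1 ≤ n - 1)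
    linarith
  refine h.congr_fun (fun y hy => ?_) measurableSet_Ioo
  simp only [smul_eq_mul]
  rw [Real.rpow_add hy.1, Real.rpow_natCast]

lemma integrableOn_norm_inv_ball (hn : 2 ≤ n) :
    IntegrableOn (fun y : EuclSp n => ‖y‖⁻¹) (Metric.ball 0 1) := by
  have := integrableOn_norm_rpow_ball hn (a := -1) (by norm_num)
  simpa [Real.rpow_neg_one] using this

lemma integrableOn_mul_of_continuous {h f : EuclSp n → ℝ} (hh : Continuous h)
    (hf : IntegrableOn f (Metric.ball 0 1)) (x : EuclSp n) :
    IntegrableOn (fun y => h (x + y) * f y) (Metric.ball 0 1) := by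
  have hc : Continuous fun y => h (x + y) := hh.comp (by fun_prop)
  obtain ⟨B, hB⟩ := (isCompact_closedBall (0 : EuclSp n) 1).exists_bound_of_continuousOn
    hc.continuousOn
  refine hf.bdd_mul (c := B) hc.aestronglyMeasurable ?_
  filter_upwards [ae_restrict_mem measurableSet_ball] with y hy
  exact hB y (Metric.ball_subset_closedBall hy)

lemma ae_ne_zero (hn : 2 ≤ n) : ∀ᵐ y : EuclSp n, y ≠ 0 := by
  have : Nontrivial (EuclSp n) := by
    have : Nonempty (Fin n) := ⟨⟨0, by omega⟩⟩
    infer_instance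
  simp [ae_iff]

lemma integrableOn_log_norm_ball (hn : 2 ≤ n) :
    IntegrableOn (fun y : EuclSp n => -Real.log ‖y‖) (Metric.ball 0 1) := by
  refine (integrableOn_norm_inv_ball hn).mono' measurable_norm.log.neg.aestronglyMeasurable ?_
  filter_upwards [ae_restrict_mem measurableSet_ball, ae_restrict_of_ae (ae_ne_zero hn)] with y hy h0
  have hy1 : ‖y‖ < 1 := by simpa using hy
  have hp : 0 < ‖y‖ := norm_pos_iff.mpr h0
  rw [Real.norm_eq_abs, abs_of_nonneg (by linarith [Real.log_nonpos hp.le hy1.le]), ← Real.log_inv]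
  linarith [Real.log_le_sub_one_of_pos (inv_pos.mpr hp)]

/-- The exponential of the logarithmic potential of a density of small mass is bounded by a
potential with the integrable kernel `1/|y|`. -/
lemma exp_logPotential_le (hn : 2 ≤ n) {h : EuclSp n → ℝ} (hh : Continuous h) (h0 : ∀ y, 0 ≤ h y)
    {x : EuclSp n} (h1 : ∫ y in Metric.ball 0 1, h (x + y) ≤ 1) :
    Real.exp (∫ y in Metric.ball 0 1, h (x + y) * (-Real.log ‖y‖)) ≤
      1 + ∫ y in Metric.ball 0 1, h (x + y) * ‖y‖⁻¹ := by
  -- The two sides differ at `y = 0`, where `log 0 = 0` and `0⁻¹ = 0` by convention.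
  have hae : (fun y : EuclSp n => h (x + y) * ‖y‖⁻¹) =ᵐ[volume.restrict (Metric.ball 0 1)]
      fun y => h (x + y) * Real.exp (-Real.log ‖y‖) := by
    filter_upwards [ae_restrict_of_ae (ae_ne_zero hn)] with y hy
    rw [← Real.log_inv, Real.exp_log (inv_pos.mpr (norm_pos_iff.mpr hy))]
  rw [integral_congr_ae hae]
  refine exp_integral_mul_le (fun y => h0 _) ?_ h1
    (integrableOn_mul_of_continuous hh (integrableOn_log_norm_ball hn) x)
    ((integrableOn_mul_of_continuous hh (integrableOn_norm_inv_ball hn) x).congr hae)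
  simpa [IntegrableOn] using integrableOn_mul_of_continuous hh (f := fun _ => 1)
    (integrableOn_const (by exact measure_ball_lt_top.ne)) x

/-- The average over dilations is dominated by a logarithmic potential, because
`∫_{|y|}^1 dt/t = -log |y|`. -/
lemma abs_integral_dilation_le (hn : 2 ≤ n) {H ψ : EuclSp n → ℝ} (hH : Continuous H)
    (hψ : Continuous ψ) (hψ0 : ∀ z, 0 ≤ ψ z) (hψ1 : ∀ z, ψ z ≤ 1)
    (hψ2 : ∀ z, 1 ≤ ‖z‖ → ψ z = 0) (x : EuclSp n) :
    |∫ t in (0 : ℝ)..1, t ^ (n - 1) * ∫ z, H (x + t • z) * ψ z| ≤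
      ∫ y in Metric.ball 0 1, |H (x + y)| * (-Real.log ‖y‖) := by
  set B : Set (EuclSp n) := Metric.ball 0 1 with hB
  set k : ℝ → EuclSp n → ℝ := fun t y => if ‖y‖ < t then t⁻¹ * |H (x + y)| else 0 with hk
  have hHx : Continuous fun y => H (x + y) := hH.comp (by fun_prop)
  have ik : Integrable (fun q : ℝ × EuclSp n => k q.1 q.2)
      ((volume.restrict (Ioc 0 1)).prod (volume.restrict B)) := by
    -- For `|y| < t` one has `t⁻¹ ≤ t^{-1/2} |y|^{-1/2}`, which is integrable on the product.
    have i1 : Integrable (fun t : ℝ => t ^ (-(1 / 2) : ℝ)) (volume.restrict (Ioc 0 1)) :=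
      (intervalIntegrable_iff_integrableOn_Ioc_of_le zero_le_one).mp
        (intervalIntegral.intervalIntegrable_rpow' (by norm_num))
    have i2 : Integrable (fun y : EuclSp n => |H (x + y)| * ‖y‖ ^ (-(1 / 2) : ℝ))
        (volume.restrict B) :=
      integrableOn_mul_of_continuous hH.abs (integrableOn_norm_rpow_ball hn (by norm_num)) x
    refine (i1.mul_prod i2).mono' ?_ ?_
    · refine Measurable.aestronglyMeasurable ?_
      refine Measurable.ite (measurableSet_lt (by fun_prop) (by fun_prop)) ?_ measurable_const
      exact (measurable_fst.inv).mul ((hHx.measurable.comp measurable_snd).abs)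
    · have hm : ∀ᵐ q ∂(volume.restrict (Ioc (0 : ℝ) 1)).prod (volume.restrict B),
          q.1 ∈ Ioc (0 : ℝ) 1 ∧ q.2 ≠ 0 := by
        refine (Measure.quasiMeasurePreserving_fst.ae (ae_restrict_mem measurableSet_Ioc)).and ?_
        exact Measure.quasiMeasurePreserving_snd.ae (ae_restrict_of_ae (ae_ne_zero hn))
      filter_upwards [hm] with q hq
      obtain ⟨⟨ht, -⟩, hy⟩ := hq
      have hy : 0 < ‖q.2‖ := norm_pos_iff.mpr hy
      simp only [hk]
      split_ifs with hlt
      · rw [Real.norm_of_nonneg (mul_nonneg (inv_nonneg.mpr ht.le) (abs_nonneg _)),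
          mul_left_comm, mul_comm]
        refine mul_le_mul_of_nonneg_left ?_ (abs_nonneg _)
        calc q.1⁻¹ = q.1 ^ (-(1 / 2) : ℝ) * q.1 ^ (-(1 / 2) : ℝ) := by
              rw [← Real.rpow_add ht, ← Real.rpow_neg_one]; norm_num
          _ ≤ q.1 ^ (-(1 / 2) : ℝ) * ‖q.2‖ ^ (-(1 / 2) : ℝ) := by
              refine mul_le_mul_of_nonneg_left ?_ (Real.rpow_nonneg ht.le _)
              exact Real.rpow_le_rpow_of_nonpos hy hlt.le (by norm_num)
      · rw [norm_zero]
        positivity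
  have hpt : ∀ t ∈ Ioc (0 : ℝ) 1, |t ^ (n - 1) * ∫ z, H (x + t • z) * ψ z| ≤ ∫ y in B, k t y := by
    intro t ht
    have e1 : |∫ z, H (x + t • z) * ψ z| ≤ ∫ z, |H (x + t • z)| * ψ z := by
      refine (abs_integral_le_integral_abs).trans_eq ?_
      simp_rw [abs_mul, abs_of_nonneg (hψ0 _)]
    have e2 : ∫ z, |H (x + t • z)| * ψ z = (t ^ n)⁻¹ * ∫ y, |H (x + y)| * ψ (t⁻¹ • y) := by
      have := Measure.integral_comp_smul (volume : Measure (EuclSp n))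
        (fun y => |H (x + y)| * ψ (t⁻¹ • y)) t
      simp only [smul_smul, inv_mul_cancel₀ ht.1.ne', one_smul] at this
      rw [this, finrank_euclideanSpace_fin, abs_of_nonneg (by have := ht.1; positivity), smul_eq_mul]
    have e3 : ∫ y, t⁻¹ * (|H (x + y)| * ψ (t⁻¹ • y)) =
        ∫ y in B, t⁻¹ * (|H (x + y)| * ψ (t⁻¹ • y)) := by
      refine (setIntegral_eq_integral_of_forall_compl_eq_zero fun y hy => ?_).symm
      have : 1 ≤ ‖y‖ := by simpa [hB] using hy
      rw [hψ2, mul_zero, mul_zero]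
      rw [norm_smul, norm_inv, Real.norm_of_nonneg ht.1.le, inv_mul_eq_div, le_div_iff₀ ht.1]
      linarith [ht.2]
    have e4 : ∫ y in B, t⁻¹ * (|H (x + y)| * ψ (t⁻¹ • y)) ≤ ∫ y in B, k t y := by
      have hcont : Continuous fun y => |H (x + y)| * ψ (t⁻¹ • y) :=
        hHx.abs.mul (hψ.comp (continuous_const_smul _))
      refine setIntegral_mono_on ?_ ?_ measurableSet_ball fun y _ => ?_
      · exact ((hcont.const_mul _).continuousOn.integrableOn_compact
          (isCompact_closedBall 0 1)).mono_set Metric.ball_subset_closedBall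
      · have ic : IntegrableOn (fun y => t⁻¹ * |H (x + y)|) B :=
          ((hHx.abs.const_mul _).continuousOn.integrableOn_compact
            (isCompact_closedBall 0 1)).mono_set Metric.ball_subset_closedBall
        exact ic.indicator (measurableSet_lt measurable_norm measurable_const)
      · simp only [hk]
        split_ifs with hlt
        · exact mul_le_mul_of_nonneg_left (mul_le_of_le_one_right (abs_nonneg _) (hψ1 _))
            (inv_nonneg.mpr ht.1.le)
        · rw [hψ2, mul_zero, mul_zero]
          rw [norm_smul, norm_inv, Real.norm_of_nonneg ht.1.le, inv_mul_eq_div, le_div_iff₀ ht.1]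
          linarith
    have hn1 : t ^ (n - 1) * (t ^ n)⁻¹ = t⁻¹ := by
      obtain ⟨j, rfl⟩ : ∃ j, n = j + 1 := ⟨n - 1, by omega⟩
      have := ht.1.ne'
      rw [Nat.add_sub_cancel, pow_succ]
      field_simp
    rw [abs_mul, abs_of_nonneg (pow_nonneg ht.1.le _)]
    refine (mul_le_mul_of_nonneg_left e1 (pow_nonneg ht.1.le _)).trans ?_
    rw [e2, ← mul_assoc, hn1, ← integral_const_mul, e3]
    exact e4
  rw [intervalIntegral.integral_of_le zero_le_one]
  have hs1 : |∫ t in Ioc (0 : ℝ) 1, t ^ (n - 1) * ∫ z, H (x + t • z) * ψ z| ≤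
      ∫ t in Ioc (0 : ℝ) 1, ∫ y in B, k t y := by
    rw [← Real.norm_eq_abs]
    refine norm_integral_le_of_norm_le ik.integral_prod_left ?_
    filter_upwards [ae_restrict_mem measurableSet_Ioc] with t ht using hpt t ht
  refine hs1.trans_eq ?_
  rw [integral_integral_swap ik]
  refine setIntegral_congr_ae measurableSet_ball ?_
  filter_upwards [ae_ne_zero hn] with y hy hyB
  have hy0 : 0 < ‖y‖ := norm_pos_iff.mpr hy
  have hy1 : ‖y‖ < 1 := by simpa [hB] using hyB
  have e1 : ∫ t in Ioc (0 : ℝ) 1, k t y = ∫ t in Ioc ‖y‖ 1, t⁻¹ * |H (x + y)| := by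
    have e : (fun t => k t y) = (Ioi ‖y‖).indicator fun t => t⁻¹ * |H (x + y)| := by
      ext t
      simp [hk, indicator_apply]
    rw [e, setIntegral_indicator measurableSet_Ioi]
    congr 2
    ext t
    simp only [mem_inter_iff, mem_Ioc, mem_Ioi]
    constructor
    · exact fun h => ⟨h.2, h.1.2⟩
    · exact fun h => ⟨⟨hy0.trans h.1, h.2⟩, h.1⟩
  rw [e1, ← intervalIntegral.integral_of_le hy1.le, intervalIntegral.integral_mul_const,
    integral_inv_of_pos hy0 one_pos, one_div, Real.log_inv, mul_comm]

end Potential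

/-! ### Averages of functions of bounded Dirichlet energy -/

section Oscillation

variable {n : ℕ}

/-- The average `∫ K(z) v(x + z) dz` of `v` around `x` with the weight `K`. -/
noncomputable def weightedAverage (K v : EuclSp n → ℝ) (x : EuclSp n) : ℝ := ∫ z, K z * v (x + z)

lemma hasCompactSupport_of_eq_zero {K : EuclSp n → ℝ} (hK : ∀ z, 1 < ‖z‖ → K z = 0) :
    HasCompactSupport K :=
  HasCompactSupport.intro (isCompact_closedBall 0 1) fun z hz => hK z (by simpa using hz)

/-- The radii `5`, `1` and `6` are chosen so that unit balls around points of the ball of radius `5`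
stay in the region where the energy is controlled. -/
lemma integral_sqrt_gradSq_le {v : EuclSp n → ℝ} (hv : ContDiff ℝ ∞ v) {E : ℝ}
    (hE : ∫ z in Metric.closedBall 0 6, gradSq v z ≤ E) {x : EuclSp n} (hx : ‖x‖ ≤ 5) :
    ∫ z in Metric.closedBall 0 1, √(gradSq v (x + z)) ≤
      volume.real (Metric.closedBall (0 : EuclSp n) 1) + E := by
  have hg := continuous_gradSq hv
  have hgx : Continuous fun z => gradSq v (x + z) := hg.comp (by fun_prop)
  have hint : ∀ {f : EuclSp n → ℝ}, Continuous f → IntegrableOn f (Metric.closedBall 0 1) :=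
    fun hf => hf.continuousOn.integrableOn_compact (isCompact_closedBall 0 1)
  have h1 : ∫ z in Metric.closedBall 0 1, √(gradSq v (x + z)) ≤
      ∫ z in Metric.closedBall 0 1, (1 + gradSq v (x + z)) := by
    refine integral_mono (hint hgx.sqrt) (hint (continuous_const.add hgx)) fun z => ?_
    rw [Real.sqrt_le_left (by linarith [gradSq_nonneg v (x + z)])]
    nlinarith [gradSq_nonneg v (x + z)]
  have h2 : ∫ z in Metric.closedBall 0 1, gradSq v (x + z) ≤ E := by
    set φ : EuclSp n → ℝ := (Metric.closedBall 0 6).indicator (gradSq v) with hφ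
    have iφ : Integrable φ := (integrable_indicator_iff measurableSet_closedBall).mpr
      (hg.continuousOn.integrableOn_compact (isCompact_closedBall 0 6))
    calc ∫ z in Metric.closedBall 0 1, gradSq v (x + z)
        = ∫ z in Metric.closedBall 0 1, φ (x + z) := by
          refine setIntegral_congr_fun measurableSet_closedBall fun z hz => ?_
          have hz1 : ‖z‖ ≤ 1 := by simpa using hz
          have : x + z ∈ Metric.closedBall (0 : EuclSp n) 6 := by
            rw [mem_closedBall_zero_iff]
            exact (norm_add_le x z).trans (by linarith)
          rw [hφ]
          exact (indicator_of_mem this _).symm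
      _ ≤ ∫ z, φ (x + z) := setIntegral_le_integral (iφ.comp_add_left x)
          (Eventually.of_forall fun z => indicator_nonneg (fun _ _ => gradSq_nonneg _ _) _)
      _ = ∫ z, φ z := integral_add_left_eq_self φ x
      _ = ∫ z in Metric.closedBall 0 6, gradSq v z := integral_indicator measurableSet_closedBall
      _ ≤ E := hE
  rw [integral_add (hint continuous_const) (hint hgx)] at h1
  simp only [integral_const, MeasurableSet.univ, measureReal_restrict_apply, univ_inter, smul_eq_mul,
    mul_one] at h1
  linarith

/-- Averages of a function of bounded Dirichlet energy are Lipschitz. -/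
lemma abs_weightedAverage_sub_le {K v : EuclSp n → ℝ} (hK : Continuous K)
    (hK0 : ∀ z, 1 < ‖z‖ → K z = 0) {b : ℝ} (hb : ∀ z, |K z| ≤ b) (hv : ContDiff ℝ ∞ v) {E : ℝ}
    (hE : ∫ z in Metric.closedBall 0 6, gradSq v z ≤ E) {x y : EuclSp n} (hx : ‖x‖ ≤ 5)
    (hy : ‖y‖ ≤ 5) :
    |weightedAverage K v x - weightedAverage K v y| ≤
      b * (volume.real (Metric.closedBall (0 : EuclSp n) 1) + E) * ‖x - y‖ := by
  have hc := hasCompactSupport_of_eq_zero hK0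
  have hf : Continuous (fderiv ℝ v) := (hv.fderiv_right (m := ∞) (by simp)).continuous
  have hd : ∀ s : ℝ, HasDerivAt (fun s : ℝ => weightedAverage K v (y + s • (x - y)))
      (∫ z, K z * fderiv ℝ v (y + s • (x - y) + z) (x - y)) s := by
    refine hasDerivAt_integral_mul hK hc (Φ := fun s z => v (y + s • (x - y) + z))
      (Φ' := fun s z => fderiv ℝ v (y + s • (x - y) + z) (x - y)) ?_ ?_ ?_
    · intro s
      exact hv.continuous.comp (by fun_prop)
    · exact (hf.comp (by fun_prop)).clm_apply continuous_const
    · intro s z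
      have h1 : HasDerivAt (fun s : ℝ => y + s • (x - y) + z) (x - y) s := by
        simpa using (((hasDerivAt_id s).smul_const (x - y)).const_add y).add_const z
      exact (hv.differentiable (by simp) _).hasFDerivAt.comp_hasDerivAt s h1
  have hbd : ∀ s ∈ Ico (0 : ℝ) 1, ‖∫ z, K z * fderiv ℝ v (y + s • (x - y) + z) (x - y)‖ ≤
      b * (volume.real (Metric.closedBall (0 : EuclSp n) 1) + E) * ‖x - y‖ := by
    intro s hs
    set p := y + s • (x - y) with hp
    have hp5 : ‖p‖ ≤ 5 := by
      have : p ∈ Metric.closedBall (0 : EuclSp n) 5 := by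
        refine (convex_closedBall (0 : EuclSp n) 5).add_smul_sub_mem ?_ ?_ ⟨hs.1, hs.2.le⟩ <;>
        simpa
      simpa using this
    have hb0 : 0 ≤ b := (abs_nonneg _).trans (hb 0)
    rw [← setIntegral_eq_integral_of_forall_compl_eq_zero (s := Metric.closedBall 0 1)
      (fun z hz => by rw [hK0 z (by simpa using hz), zero_mul])]
    have h1 : ‖∫ z in Metric.closedBall 0 1, K z * fderiv ℝ v (p + z) (x - y)‖ ≤
        ∫ z in Metric.closedBall 0 1, b * ‖x - y‖ * √(gradSq v (p + z)) := by
      refine norm_integral_le_of_norm_le ?_ (Eventually.of_forall fun z => ?_)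
      · have : Continuous fun z => b * ‖x - y‖ * √(gradSq v (p + z)) :=
          continuous_const.mul ((continuous_gradSq hv).comp (by fun_prop)).sqrt
        exact this.continuousOn.integrableOn_compact (isCompact_closedBall 0 1)
      · rw [norm_mul, mul_assoc, Real.norm_eq_abs, Real.norm_eq_abs]
        exact mul_le_mul (hb z) (abs_fderiv_apply_le _ _ _) (abs_nonneg _) hb0
    rw [integral_const_mul] at h1
    refine h1.trans ?_
    have h2 := integral_sqrt_gradSq_le hv hE hp5
    calc b * ‖x - y‖ * _ ≤ b * ‖x - y‖ * _ :=
          mul_le_mul_of_nonneg_left h2 (mul_nonneg hb0 (norm_nonneg _))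
      _ = _ := by ring
  have := norm_image_sub_le_of_norm_deriv_le_segment_01'
    (fun s _ => (hd s).hasDerivWithinAt) hbd
  simpa using this

lemma continuous_weightedAverage {K v : EuclSp n → ℝ} (hK : Continuous K)
    (hK0 : ∀ z, 1 < ‖z‖ → K z = 0) (hv : Continuous v) : Continuous (weightedAverage K v) := by
  have e : weightedAverage K v = fun x => ∫ z in Metric.closedBall 0 1, K z * v (x + z) := by
    ext x
    rw [weightedAverage, setIntegral_eq_integral_of_forall_compl_eq_zero
      (fun z hz => by rw [hK0 z (by simpa using hz), zero_mul])]
  rw [e]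
  exact continuous_parametric_integral_of_continuous (by fun_prop) (isCompact_closedBall 0 1)

lemma abs_weightedAverage_sub_self_le {K f : EuclSp n → ℝ} (hK : Continuous K)
    (hK0 : ∀ z, 1 < ‖z‖ → K z = 0) (hK1 : ∫ z, K z = 1) (hf : Continuous f) {x : EuclSp n} {L : ℝ}
    (hL : ∀ z, ‖z‖ ≤ 1 → |f (x + z) - f x| ≤ L) :
    |weightedAverage K f x - f x| ≤ (∫ z, |K z|) * L := by
  have hc := hasCompactSupport_of_eq_zero hK0
  have iK : Integrable K := hK.integrable_of_hasCompactSupport hc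
  have i1 : Integrable (fun z => K z * f (x + z)) :=
    (hK.mul (hf.comp (by fun_prop))).integrable_of_hasCompactSupport hc.mul_right
  have e : weightedAverage K f x - f x = ∫ z, K z * (f (x + z) - f x) := by
    simp_rw [mul_sub]
    rw [integral_sub i1 (iK.mul_const _), integral_mul_const, hK1, one_mul, weightedAverage]
  rw [e, ← integral_mul_const, ← Real.norm_eq_abs]
  refine norm_integral_le_of_norm_le (iK.abs.mul_const L) (Eventually.of_forall fun z => ?_)
  rw [norm_mul, Real.norm_eq_abs, Real.norm_eq_abs]
  by_cases hz : ‖z‖ ≤ 1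
  · exact mul_le_mul_of_nonneg_left (hL z hz) (abs_nonneg _)
  · rw [hK0 z (not_le.mp hz)]
    simp

lemma weightedAverage_comm {K ρ v : EuclSp n → ℝ} (hK : Continuous K)
    (hK0 : ∀ z, 1 < ‖z‖ → K z = 0) (hρ : Continuous ρ) (hρ0 : ∀ z, 1 < ‖z‖ → ρ z = 0)
    (hv : Continuous v) (x : EuclSp n) :
    weightedAverage ρ (weightedAverage K v) x = weightedAverage K (weightedAverage ρ v) x := by
  simp only [weightedAverage, ← integral_const_mul]
  rw [integral_integral_swap]
  · congr 1
    ext z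
    congr 1
    ext w
    rw [add_right_comm]
    ring
  · refine Continuous.integrable_of_hasCompactSupport ?_ ?_
    · simp only [Function.uncurry_def]
      fun_prop
    · refine HasCompactSupport.intro ((isCompact_closedBall (0 : EuclSp n) 1).prod
        (isCompact_closedBall (0 : EuclSp n) 1)) fun q hq => ?_
      simp only [mem_prod, not_and_or, mem_closedBall_zero_iff, not_le] at hq
      rcases hq with h | h
      · simp [Function.uncurry_def, hρ0 _ h]
      · simp [Function.uncurry_def, hK0 _ h]

/-- Two averages of a function of bounded Dirichlet energy differ by a bounded amount: both are
compared with the double average, in which the order of averaging does not matter. -/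
lemma abs_weightedAverage_sub_weightedAverage_le {K ρ v : EuclSp n → ℝ} (hK : Continuous K)
    (hK0 : ∀ z, 1 < ‖z‖ → K z = 0) (hK1 : ∫ z, K z = 1) (hρ : Continuous ρ)
    (hρ0 : ∀ z, 1 < ‖z‖ → ρ z = 0) (hρ1 : ∫ z, ρ z = 1) {b : ℝ} (hKb : ∀ z, |K z| ≤ b)
    (hρb : ∀ z, |ρ z| ≤ b) (hv : ContDiff ℝ ∞ v) {E : ℝ} (hE0 : 0 ≤ E)
    (hE : ∫ z in Metric.closedBall 0 6, gradSq v z ≤ E) {x : EuclSp n} (hx : ‖x‖ ≤ 4) :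
    |weightedAverage K v x - weightedAverage ρ v 0| ≤
      ((∫ z, |ρ z|) + (∫ z, |K z|) + 4) *
        (b * (volume.real (Metric.closedBall (0 : EuclSp n) 1) + E)) := by
  set L := b * (volume.real (Metric.closedBall (0 : EuclSp n) 1) + E) with hL
  have hL0 : 0 ≤ L := mul_nonneg ((abs_nonneg _).trans (hKb 0)) (add_nonneg measureReal_nonneg hE0)
  have hstep : ∀ z : EuclSp n, ‖z‖ ≤ 1 → ‖x + z‖ ≤ 5 := fun z hz =>
    (norm_add_le x z).trans (by linarith)
  have hosc : ∀ W : EuclSp n → ℝ, Continuous W → (∀ z, 1 < ‖z‖ → W z = 0) → (∀ z, |W z| ≤ b) →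
      ∀ z, ‖z‖ ≤ 1 → |weightedAverage W v (x + z) - weightedAverage W v x| ≤ L := by
    intro W hW hW0 hWb z hz
    refine (abs_weightedAverage_sub_le hW hW0 hWb hv hE (hstep z hz) (by linarith)).trans ?_
    rw [add_sub_cancel_left]
    exact mul_le_of_le_one_right hL0 hz
  have h1 := abs_weightedAverage_sub_self_le hρ hρ0 hρ1
    (continuous_weightedAverage hK hK0 hv.continuous) (hosc K hK hK0 hKb)
  have h2 := abs_weightedAverage_sub_self_le hK hK0 hK1
    (continuous_weightedAverage hρ hρ0 hv.continuous) (hosc ρ hρ hρ0 hρb)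
  rw [← weightedAverage_comm hK hK0 hρ hρ0 hv.continuous] at h2
  have h3 := abs_weightedAverage_sub_le (x := x) (y := 0) hρ hρ0 hρb hv hE (by linarith) (by simp)
  rw [sub_zero] at h3
  have h4 : L * ‖x‖ ≤ L * 4 := mul_le_mul_of_nonneg_left hx hL0
  rw [abs_le] at *
  constructor <;> linarith [h1.1, h1.2, h2.1, h2.2, h3.1, h3.2]

end Oscillation

/-! ### Representation formula and the local exponential estimate -/

section LocalEstimate

/-- The radial cutoff `ψ` on `ℝⁿ`, equal to `1` near the origin and to `0` outside the unit ball. -/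
noncomputable def plateau (n : ℕ) (z : EuclSp n) : ℝ := cutoffProfile (‖z‖ ^ 2)

/-- The weight `χ` on `ℝ^{2m}` with `z χ(z) = -∇(-Δ)^{m-1}ψ(z)`, where `ψ` is `plateau`. -/
noncomputable def reprWeight (m : ℕ) : EuclSp (2 * m) → ℝ :=
  radialWeight (2 * m) ((radialNegLap (2 * m))^[m - 1] cutoffProfile)

lemma contDiff_plateau (n : ℕ) : ContDiff ℝ ∞ (plateau n) := contDiff_radial contDiff_cutoffProfile

lemma plateau_eq_zero {n : ℕ} {z : EuclSp n} (hz : 1 ≤ ‖z‖) : plateau n z = 0 :=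
  Real.smoothTransition.zero_of_nonpos (by nlinarith)

lemma plateau_nonneg {n : ℕ} (z : EuclSp n) : 0 ≤ plateau n z := Real.smoothTransition.nonneg _

lemma plateau_le_one {n : ℕ} (z : EuclSp n) : plateau n z ≤ 1 := Real.smoothTransition.le_one _

lemma hasCompactSupport_plateau (n : ℕ) : HasCompactSupport (plateau n) :=
  hasCompactSupport_radial cutoffProfile_eq_zero

lemma contDiff_reprWeight (m : ℕ) : ContDiff ℝ ∞ (reprWeight m) :=
  contDiff_radialWeight (contDiff_iterate_radialNegLap contDiff_cutoffProfile _)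

lemma reprWeight_eq_zero {m : ℕ} {z : EuclSp (2 * m)} (hz : 1 < ‖z‖) : reprWeight m z = 0 :=
  radialWeight_eq_zero (iterate_radialNegLap_eq_zero_beyond cutoffProfile_eq_zero _) hz

/-- The mass of `χ` does not vanish. This is the nondegeneracy that makes the logarithm a
fundamental solution of `(-Δ)^m` on `ℝ^{2m}`. -/
lemma integral_reprWeight_ne_zero {m : ℕ} (hm : 0 < m) : ∫ z, reprWeight m z ≠ 0 := by
  rw [reprWeight, integral_radialWeight hm
    (contDiff_iterate_radialNegLap contDiff_cutoffProfile _)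
    (iterate_radialNegLap_eq_zero_beyond cutoffProfile_eq_zero _)]
  refine mul_ne_zero (mul_ne_zero ?_ ?_) (moment_iterate_radialNegLap_ne_zero
    contDiff_cutoffProfile cutoffProfile_eq_zero ?_ (m - 1) (by omega))
  · have : (0 : ℝ) < m := by exact_mod_cast hm
    linarith
  · exact (ENNReal.toReal_pos (Metric.measure_ball_pos _ _ one_pos).ne' measure_ball_lt_top.ne).ne'
  · rw [cutoffProfile_eq_one (by norm_num)]
    exact one_ne_zero

/-- Representation of a function on `ℝ^{2m}` by an average at unit scale and `(-Δ)^m v`. -/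
lemma integral_reprWeight_mul {m : ℕ} (hm : 0 < m) {v : EuclSp (2 * m) → ℝ}
    (hv : ContDiff ℝ ∞ v) (x : EuclSp (2 * m)) :
    (∫ z, reprWeight m z) * v x = (∫ z, reprWeight m z * v (x + z)) +
      ∫ t in (0 : ℝ)..1, t ^ (2 * m - 1) * ∫ z, negLap^[m] v (x + t • z) * plateau (2 * m) z := by
  have hψ := contDiff_plateau (2 * m)
  have hχc : HasCompactSupport (reprWeight m) :=
    hasCompactSupport_of_eq_zero fun z hz => reprWeight_eq_zero hz
  have hrel : ∀ i z, z i * reprWeight m z = -partialD i (negLap^[m - 1] (plateau (2 * m))) z := by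
    intro i z
    have e : negLap^[m - 1] (plateau (2 * m)) = _ := iterate_negLap_radial contDiff_cutoffProfile _
    rw [e]
    exact mul_radialWeight (contDiff_iterate_radialNegLap contDiff_cutoffProfile _) i z
  have hd := fun t => hasDerivAt_dilation_iterate hv (contDiff_reprWeight m).continuous hχc hψ
    (hasCompactSupport_plateau _) (m - 1) hrel x t
  rw [show 2 * (m - 1) + 1 = 2 * m - 1 by omega, show m - 1 + 1 = m by omega] at hd
  have hH : ContDiff ℝ ∞ (negLap^[m] v) := hv.iterate_negLap m
  have hcont : Continuous fun t : ℝ => ∫ z, negLap^[m] v (x + t • z) * plateau (2 * m) z := by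
    have e : (fun t : ℝ => ∫ z, negLap^[m] v (x + t • z) * plateau (2 * m) z) =
        fun t => ∫ z in Metric.closedBall 0 1, negLap^[m] v (x + t • z) * plateau (2 * m) z := by
      ext t
      refine (setIntegral_eq_integral_of_forall_compl_eq_zero fun z hz => ?_).symm
      have : 1 < ‖z‖ := by simpa using hz
      rw [plateau_eq_zero this.le, mul_zero]
    rw [e]
    refine continuous_parametric_integral_of_continuous ?_ (isCompact_closedBall 0 1)
    exact (hH.continuous.comp (by fun_prop)).mul (hψ.continuous.comp continuous_snd)
  have hftc := intervalIntegral.integral_eq_sub_of_hasDerivAt (a := 0) (b := 1)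
    (fun t _ => hd t) (((continuous_pow _).neg.mul hcont).intervalIntegrable _ _)
  simp only [one_smul, zero_smul, add_zero, integral_mul_const, neg_mul,
    intervalIntegral.integral_neg] at hftc
  linarith

lemma setIntegral_comp_add_le {n : ℕ} {h : EuclSp n → ℝ} (hh : Continuous h) (h0 : ∀ y, 0 ≤ h y)
    {A A' : Set (EuclSp n)} (hA : MeasurableSet A) (hA' : IsCompact A') {y : EuclSp n}
    (hAA : ∀ x ∈ A, x + y ∈ A') :
    ∫ x in A, h (x + y) ≤ ∫ z in A', h z := by
  set φ : EuclSp n → ℝ := A'.indicator h with hφ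
  have iφ : Integrable φ := (integrable_indicator_iff hA'.measurableSet).mpr
    (hh.continuousOn.integrableOn_compact hA')
  calc ∫ x in A, h (x + y) = ∫ x in A, φ (x + y) := by
        refine setIntegral_congr_fun hA fun x hx => ?_
        exact (indicator_of_mem (hAA x hx) _).symm
    _ ≤ ∫ x, φ (x + y) := setIntegral_le_integral (iφ.comp_add_right y)
        (Eventually.of_forall fun z => indicator_nonneg (fun _ _ => h0 _) _)
    _ = ∫ x, φ x := integral_add_right_eq_self φ y
    _ = ∫ z in A', h z := integral_indicator hA'.measurableSet

/-- The closed annulus `a ≤ |x| ≤ b`. -/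
def annulus (n : ℕ) (a b : ℝ) : Set (EuclSp n) := {x | a ≤ ‖x‖ ∧ ‖x‖ ≤ b}

lemma isCompact_annulus (n : ℕ) (a b : ℝ) : IsCompact (annulus n a b) := by
  refine (isCompact_closedBall (0 : EuclSp n) b).of_isClosed_subset ?_ fun x hx => by simpa using hx.2
  exact (isClosed_le continuous_const continuous_norm).inter
    (isClosed_le continuous_norm continuous_const)

lemma integral_potential_annulus_le {n : ℕ} (hn : 2 ≤ n) {h : EuclSp n → ℝ} (hh : Continuous h)
    (h0 : ∀ y, 0 ≤ h y) (h1 : ∫ y in annulus n 1 5, h y ≤ 1) :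
    IntegrableOn (fun x => ∫ y in Metric.ball 0 1, h (x + y) * ‖y‖⁻¹) (annulus n 2 4) ∧
    ∫ x in annulus n 2 4, ∫ y in Metric.ball 0 1, h (x + y) * ‖y‖⁻¹ ≤
      ∫ y in Metric.ball (0 : EuclSp n) 1, ‖y‖⁻¹ := by
  set B : Set (EuclSp n) := Metric.ball 0 1 with hB
  set A := annulus n 2 4 with hA
  have hAm : MeasurableSet A := (isCompact_annulus n 2 4).measurableSet
  have hmem : ∀ x ∈ A, ∀ y ∈ B, x + y ∈ annulus n 1 5 := by
    intro x hx y hy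
    have hy1 : ‖y‖ < 1 := by simpa [hB] using hy
    have h1 := norm_add_le x y
    have h2 := norm_sub_le_norm_add x y
    exact ⟨by linarith [hx.1], by linarith [hx.2]⟩
  obtain ⟨b, hb⟩ := (isCompact_annulus n 1 5).exists_bound_of_continuousOn hh.continuousOn
  have hfin : IsFiniteMeasure (volume.restrict A) :=
    ⟨by simpa using (isCompact_annulus n 2 4).measure_lt_top⟩
  have ip : Integrable (fun q : EuclSp n × EuclSp n => h (q.1 + q.2) * ‖q.2‖⁻¹)
      ((volume.restrict A).prod (volume.restrict B)) := by
    have i1 : Integrable (fun q : EuclSp n × EuclSp n => (1 : ℝ) * ‖q.2‖⁻¹)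
        ((volume.restrict A).prod (volume.restrict B)) :=
      (integrable_const (1 : ℝ)).mul_prod (integrableOn_norm_inv_ball hn)
    simp only [one_mul] at i1
    refine i1.bdd_mul (c := b) (hh.comp (by fun_prop)).aestronglyMeasurable ?_
    have hm : ∀ᵐ q ∂(volume.restrict A).prod (volume.restrict B), q.1 ∈ A ∧ q.2 ∈ B :=
      (Measure.quasiMeasurePreserving_fst.ae (ae_restrict_mem hAm)).and
        (Measure.quasiMeasurePreserving_snd.ae (ae_restrict_mem measurableSet_ball))
    filter_upwards [hm] with q hq using hb _ (hmem _ hq.1 _ hq.2)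
  refine ⟨ip.integral_prod_left, ?_⟩
  rw [integral_integral_swap ip]
  refine integral_mono_ae ip.integral_prod_right (integrableOn_norm_inv_ball hn) ?_
  filter_upwards [ae_restrict_mem measurableSet_ball] with y hy
  rw [integral_mul_const]
  refine mul_le_of_le_one_left (inv_nonneg.mpr (norm_nonneg _)) ?_
  exact (setIntegral_comp_add_le hh h0 hAm (isCompact_annulus n 1 5)
    fun x hx => hmem x hx y hy).trans h1

/-- The average of `v` over the annulus `1/2 ≤ |z| ≤ 1`, with the weight `-∇ψ(z)·z/|z|²`
normalised to mass one. -/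
noncomputable def annularMean {n : ℕ} (v : EuclSp n → ℝ) : ℝ :=
  (∫ z, radialWeight n cutoffProfile z * v z) / ∫ z, radialWeight n cutoffProfile z

/-- If the Dirichlet energy of `v` is bounded and the `L¹` norm of `(-Δ)^m v` is small, then
`e^{2mv}` is controlled in the mean by the exponential of the mean of `v`. -/
lemma exists_local_bound {n m : ℕ} (hnm : n = 2 * m) (hm : 0 < m) :
    ∃ δ : ℝ, 0 < δ ∧ ∀ E : ℝ, 0 ≤ E → ∃ C : ℝ, 0 < C ∧ ∀ v : EuclSp n → ℝ, ContDiff ℝ ∞ v →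
      ∫ z in Metric.closedBall 0 6, gradSq v z ≤ E →
      ∫ z in annulus n 1 5, |negLap^[m] v z| ≤ δ →
      ∫ x in annulus n 2 4, Real.exp (n * v x) ≤ C * Real.exp (n * annularMean v) := by
  subst hnm
  set n := 2 * m with hn
  have hn2 : 2 ≤ n := by omega
  have hnpos : (0 : ℝ) < (n : ℕ) := by exact_mod_cast (by omega : 0 < n)
  set c := ∫ z, reprWeight m z with hc
  have hc0 : c ≠ 0 := integral_reprWeight_ne_zero hm
  set d := ∫ z, radialWeight n cutoffProfile z with hd
  have hd0 : 0 < d := integral_radialWeight_cutoffProfile_pos (by omega)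
  set K : EuclSp n → ℝ := fun z => c⁻¹ * reprWeight m z with hK
  set ρ : EuclSp n → ℝ := fun z => d⁻¹ * radialWeight n cutoffProfile z with hρ
  have hKc : Continuous K := continuous_const.mul (contDiff_reprWeight m).continuous
  have hρc : Continuous ρ :=
    continuous_const.mul (contDiff_radialWeight contDiff_cutoffProfile).continuous
  have hK0 : ∀ z, 1 < ‖z‖ → K z = 0 := fun z hz => by
    simp only [hK, reprWeight_eq_zero hz, mul_zero]
  have hρ0 : ∀ z, 1 < ‖z‖ → ρ z = 0 := fun z hz => by
    simp only [hρ, radialWeight_eq_zero cutoffProfile_eq_zero hz, mul_zero]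
  have hK1 : ∫ z, K z = 1 := by
    rw [hK, integral_const_mul, ← hc, inv_mul_cancel₀ hc0]
  have hρ1 : ∫ z, ρ z = 1 := by
    rw [hρ, integral_const_mul, ← hd, inv_mul_cancel₀ hd0.ne']
  obtain ⟨b₁, hb₁⟩ := hKc.bounded_above_of_compact_support (hasCompactSupport_of_eq_zero hK0)
  obtain ⟨b₂, hb₂⟩ := hρc.bounded_above_of_compact_support (hasCompactSupport_of_eq_zero hρ0)
  have hKb : ∀ z, |K z| ≤ max b₁ b₂ := fun z => (hb₁ z).trans (le_max_left _ _)
  have hρb : ∀ z, |ρ z| ≤ max b₁ b₂ := fun z => (hb₂ z).trans (le_max_right _ _)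
  set β := n * |c|⁻¹ with hβ
  have hβ0 : 0 < β := mul_pos hnpos (inv_pos.mpr (abs_pos.mpr hc0))
  -- With mass at most `β⁻¹`, the density `h` below has mass at most one.
  refine ⟨β⁻¹, inv_pos.mpr hβ0, fun E hE0 => ?_⟩
  set L := ((∫ z, |ρ z|) + (∫ z, |K z|) + 4) *
    (max b₁ b₂ * (volume.real (Metric.closedBall (0 : EuclSp n) 1) + E)) with hL
  set W := ∫ y in Metric.ball (0 : EuclSp n) 1, ‖y‖⁻¹ with hW
  have hW0 : 0 ≤ W := integral_nonneg fun y => inv_nonneg.mpr (norm_nonneg _)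
  set A := annulus n 2 4 with hA
  have hAm : MeasurableSet A := (isCompact_annulus n 2 4).measurableSet
  refine ⟨Real.exp (n * L) * (volume.real A + W + 1),
    mul_pos (Real.exp_pos _) (by have := measureReal_nonneg (μ := volume) (s := A); linarith),
    fun v hv hvE hvδ => ?_⟩
  set h : EuclSp n → ℝ := fun y => β * |negLap^[m] v y| with hh
  have hhc : Continuous h := continuous_const.mul (hv.iterate_negLap m).continuous.abs
  have hh0 : ∀ y, 0 ≤ h y := fun y => mul_nonneg hβ0.le (abs_nonneg _)
  have hh1 : ∫ y in annulus n 1 5, h y ≤ 1 := by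
    rw [hh, integral_const_mul]
    calc β * _ ≤ β * β⁻¹ := mul_le_mul_of_nonneg_left hvδ hβ0.le
      _ = 1 := mul_inv_cancel₀ hβ0.ne'
  have hM : annularMean v = weightedAverage ρ v 0 := by
    simp only [annularMean, weightedAverage, hρ, zero_add, mul_assoc, integral_const_mul]
    rw [div_eq_inv_mul]
  have hpt : ∀ x ∈ A, Real.exp (n * v x) ≤ Real.exp (n * L) * Real.exp (n * annularMean v) *
      (1 + ∫ y in Metric.ball 0 1, h (x + y) * ‖y‖⁻¹) := by
    intro x hx
    have hosc := abs_weightedAverage_sub_weightedAverage_le hKc hK0 hK1 hρc hρ0 hρ1 hKb hρb hv hE0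
      hvE hx.2
    rw [← hM, ← hL] at hosc
    have hrep := integral_reprWeight_mul hm hv x
    have hJ := abs_integral_dilation_le hn2 (hv.iterate_negLap m).continuous
      (contDiff_plateau n).continuous plateau_nonneg plateau_le_one (fun z hz => plateau_eq_zero hz) x
    set J := ∫ t in (0 : ℝ)..1, t ^ (n - 1) * ∫ z, negLap^[m] v (x + t • z) * plateau n z with hJdef
    have hvx : v x = weightedAverage K v x + c⁻¹ * J := by
      have : weightedAverage K v x = c⁻¹ * ∫ z, reprWeight m z * v (x + z) := by
        simp only [weightedAverage, hK, mul_assoc, integral_const_mul]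
        rfl
      rw [this, ← mul_add, ← hrep, ← hc, ← mul_assoc, inv_mul_cancel₀ hc0, one_mul]
    have hI : n * (c⁻¹ * J) ≤ ∫ y in Metric.ball 0 1, h (x + y) * (-Real.log ‖y‖) := by
      have e : ∫ y in Metric.ball 0 1, h (x + y) * (-Real.log ‖y‖) =
          β * ∫ y in Metric.ball 0 1, |negLap^[m] v (x + y)| * (-Real.log ‖y‖) := by
        simp only [hh, mul_assoc, integral_const_mul]
      rw [e, hβ, mul_assoc]
      refine mul_le_mul_of_nonneg_left ?_ hnpos.le
      calc c⁻¹ * J ≤ |c⁻¹ * J| := le_abs_self _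
        _ = |c|⁻¹ * |J| := by rw [abs_mul, abs_inv]
        _ ≤ _ := mul_le_mul_of_nonneg_left hJ (inv_nonneg.mpr (abs_nonneg _))
    have hmass : ∫ y in Metric.ball 0 1, h (x + y) ≤ 1 := by
      simp_rw [add_comm x]
      refine (setIntegral_comp_add_le hhc hh0 measurableSet_ball (isCompact_annulus n 1 5)
        fun y hy => ?_).trans hh1
      have hy1 : ‖y‖ < 1 := by simpa using hy
      have h1 := norm_add_le y x
      have h2 := norm_sub_le_norm_add x y
      rw [add_comm x y] at h2
      exact ⟨by linarith [hx.1], by linarith [hx.2]⟩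
    have hexp := exp_logPotential_le hn2 hhc hh0 hmass
    calc Real.exp (n * v x) ≤ Real.exp (n * L + n * annularMean v +
          ∫ y in Metric.ball 0 1, h (x + y) * (-Real.log ‖y‖)) := by
          refine Real.exp_le_exp.mpr ?_
          rw [hvx, mul_add, ← mul_add]
          have := mul_le_mul_of_nonneg_left ((abs_le.mp hosc).2) hnpos.le
          linarith
      _ ≤ _ := by
          rw [Real.exp_add, Real.exp_add]
          exact mul_le_mul_of_nonneg_left hexp (by positivity)
  obtain ⟨hi, hle⟩ := integral_potential_annulus_le hn2 hhc hh0 hh1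
  have hvc := hv.continuous
  have h1 : IntegrableOn (fun x => Real.exp (n * v x)) A :=
    (Continuous.continuousOn (by fun_prop)).integrableOn_compact (isCompact_annulus n 2 4)
  have hone : IntegrableOn (fun _ : EuclSp n => (1 : ℝ)) A :=
    continuousOn_const.integrableOn_compact (isCompact_annulus n 2 4)
  have h2 := setIntegral_mono_on h1 ((hone.add hi).const_mul _) hAm hpt
  refine h2.trans ?_
  simp only [Pi.add_apply]
  rw [integral_const_mul, integral_add hone hi]
  simp only [integral_const, MeasurableSet.univ, measureReal_restrict_apply, univ_inter, smul_eq_mul,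
    mul_one]
  rw [mul_right_comm]
  refine mul_le_mul_of_nonneg_right (mul_le_mul_of_nonneg_left (by linarith) (Real.exp_pos _).le)
    (Real.exp_pos _).le

end LocalEstimate

/-! ### Means over large annuli -/

section Means

variable {n : ℕ}

/-- If `u` is superharmonic outside a ball, then its averages over the annuli
`R/2 ≤ |x| ≤ R` are bounded above: their derivative in `R` only sees the part of `Δu` inside the
ball, and is `O(R^{1-n})`. -/
lemma exists_integral_radialWeight_mul_le (hn : 3 ≤ n) {u : EuclSp n → ℝ} (hu : ContDiff ℝ ∞ u)
    {R₀ : ℝ} (hsup : ∀ x, R₀ < ‖x‖ → 0 ≤ negLap u x) :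
    ∃ C : ℝ, ∀ R : ℝ, 1 ≤ R → ∫ z, radialWeight n cutoffProfile z * u (R • z) ≤ C := by
  set φ : EuclSp n → ℝ := (Metric.closedBall 0 R₀).indicator fun x => |negLap u x| with hφ
  have hφ0 : ∀ x, 0 ≤ φ x := fun x => indicator_nonneg (fun _ _ => abs_nonneg _) x
  have iφ : Integrable φ := (integrable_indicator_iff measurableSet_closedBall).mpr
    (hu.negLap.continuous.abs.continuousOn.integrableOn_compact (isCompact_closedBall 0 R₀))
  set J := ∫ x, φ x with hJ
  have hJ0 : 0 ≤ J := integral_nonneg hφ0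
  set F : ℝ → ℝ := fun R => ∫ z, radialWeight n cutoffProfile z * u (R • z) with hF
  have hd : ∀ R, HasDerivAt F (-R * ∫ z, negLap u (R • z) * plateau n z) R := by
    intro R
    simpa using hasDerivAt_dilation hu (contDiff_radialWeight contDiff_cutoffProfile).continuous
      (hasCompactSupport_radialWeight cutoffProfile_eq_zero) (contDiff_plateau n)
      (hasCompactSupport_plateau n) (mul_radialWeight contDiff_cutoffProfile) 0 R
  have hbd : ∀ R, 1 ≤ R → -R * ∫ z, negLap u (R • z) * plateau n z ≤ J / R ^ 2 := by
    intro R hR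
    have hR0 : 0 < R := by linarith
    have h1 : ∫ z, -φ (R • z) ≤ ∫ z, negLap u (R • z) * plateau n z := by
      refine integral_mono (iφ.comp_smul hR0.ne').neg ?_ fun z => ?_
      · exact ((contDiff_comp_smul hu.negLap R).continuous.mul
          (contDiff_plateau n).continuous).integrable_of_hasCompactSupport
          (hasCompactSupport_plateau n).mul_left
      · have p0 := plateau_nonneg z
        have p1 := plateau_le_one z
        by_cases hz : R₀ < ‖R • z‖
        · have := mul_nonneg (hsup _ hz) p0
          have := hφ0 (R • z)
          simp only
          linarith
        · have hz' : R • z ∈ Metric.closedBall (0 : EuclSp n) R₀ := by simpa using hz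
          simp only [hφ, indicator_of_mem hz']
          nlinarith [neg_abs_le (negLap u (R • z)), abs_nonneg (negLap u (R • z))]
    rw [integral_neg, Measure.integral_comp_smul, finrank_euclideanSpace_fin, smul_eq_mul,
      abs_of_nonneg (by positivity)] at h1
    have h2 : R * ((R ^ n)⁻¹ * J) ≤ J / R ^ 2 := by
      obtain ⟨k, rfl⟩ : ∃ k, n = k + 3 := ⟨n - 3, by omega⟩
      have : R * ((R ^ (k + 3))⁻¹ * J) = (J / R ^ 2) * (R ^ k)⁻¹ := by
        field_simp
        ring
      rw [this]
      exact mul_le_of_le_one_right (by positivity) (inv_le_one_of_one_le₀ (one_le_pow₀ hR))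
    nlinarith
  -- Adding `J / R` compensates the possible growth, and makes the averages nonincreasing.
  have hinv : ∀ R : ℝ, 0 < R → HasDerivAt (fun R => F R + J * R⁻¹)
      (-R * (∫ z, negLap u (R • z) * plateau n z) + J * -(R ^ 2)⁻¹) R := fun R hR =>
    (hd R).add ((hasDerivAt_inv hR.ne').const_mul J)
  have hanti : AntitoneOn (fun R => F R + J * R⁻¹) (Ici 1) := by
    refine antitoneOn_of_deriv_nonpos (convex_Ici 1) ?_ ?_ ?_
    · exact fun R hR => (hinv R (by linarith [mem_Ici.mp hR])).continuousAt.continuousWithinAt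
    · rw [interior_Ici]
      exact fun R hR => (hinv R (by linarith [mem_Ioi.mp hR])).differentiableAt.differentiableWithinAt
    · rw [interior_Ici]
      intro R hR
      rw [(hinv R (by linarith [mem_Ioi.mp hR])).deriv]
      have := hbd R (mem_Ioi.mp hR).le
      rw [div_eq_mul_inv] at this
      linarith
  refine ⟨F 1 + J, fun R hR => ?_⟩
  have h := hanti (mem_Ici.mpr le_rfl) (mem_Ici.mpr hR) hR
  have h2 : 0 ≤ J * R⁻¹ := mul_nonneg hJ0 (inv_nonneg.mpr (by linarith))
  simp only [inv_one, mul_one] at h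
  change F R ≤ _
  linarith

/-- Jensen's inequality for the annular mean. -/
lemma exp_annularMean_le (hn : 0 < n) {v : EuclSp n → ℝ} (hv : Continuous v) :
    (∫ z, radialWeight n cutoffProfile z) * Real.exp (2 * annularMean v) ≤
      ∫ z, radialWeight n cutoffProfile z * Real.exp (2 * v z) := by
  set ρ := radialWeight n cutoffProfile with hρ
  have hρc : Continuous ρ := (contDiff_radialWeight contDiff_cutoffProfile).continuous
  have hρs : HasCompactSupport ρ := hasCompactSupport_radialWeight cutoffProfile_eq_zero
  have hd0 : 0 < ∫ z, ρ z := integral_radialWeight_cutoffProfile_pos hn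
  set M := annularMean v with hM
  have hMd : ∫ z, ρ z * v z = M * ∫ z, ρ z := by
    rw [hM, annularMean, ← hρ, div_mul_cancel₀ _ hd0.ne']
  have i0 : Integrable ρ := hρc.integrable_of_hasCompactSupport hρs
  have i1 : Integrable (fun z => ρ z * v z) :=
    (hρc.mul hv).integrable_of_hasCompactSupport hρs.mul_right
  have i2 : Integrable (fun z => ρ z * Real.exp (2 * v z)) :=
    Continuous.integrable_of_hasCompactSupport (by fun_prop) hρs.mul_right
  have hpt : ∀ z, Real.exp (2 * M) * ((1 - 2 * M) * ρ z + 2 * (ρ z * v z)) ≤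
      ρ z * Real.exp (2 * v z) := by
    intro z
    have e1 : Real.exp (2 * v z) = Real.exp (2 * M) * Real.exp (2 * v z - 2 * M) := by
      rw [← Real.exp_add]; congr 1; ring
    have e2 := Real.add_one_le_exp (2 * v z - 2 * M)
    rw [e1]
    nlinarith [mul_le_mul_of_nonneg_left e2
      (mul_nonneg (radialWeight_cutoffProfile_nonneg z) (Real.exp_pos (2 * M)).le)]
  have h := integral_mono (((i0.const_mul _).add (i1.const_mul 2)).const_mul _) i2 hpt
  simp only [Pi.add_apply] at h
  rw [integral_const_mul, integral_add (i0.const_mul _) (i1.const_mul _), integral_const_mul,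
    integral_const_mul, hMd] at h
  linarith

/-- The curvature lower bound turns the uniform energy bound into a decay estimate for `e^{2u}` in
the mean over annuli. -/
lemma exists_integral_radialWeight_mul_exp_le {u η : EuclSp n → ℝ} (hu : ContDiff ℝ ∞ u)
    (hη : ContDiff ℝ ∞ η) (hc : HasCompactSupport η) (hη1 : ∀ z, ‖z‖ ≤ 1 → η z = 1) {R₀ c p E : ℝ}
    (hc0 : 0 < c) (hp : 0 ≤ p)
    (hP : ∀ x, R₀ < ‖x‖ → c * ‖x‖ ^ (-p) * Real.exp (2 * u x) ≤ scalarPart u x)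
    (hE : ∀ R : ℝ, 1 ≤ R → ∫ z, {z : EuclSp n | R₀ < ‖R • z‖}.indicator
        (fun z => η z ^ 2 * scalarPart (fun z => u (R • z)) z) z ≤ E) :
    ∃ C : ℝ, ∀ R : ℝ, 1 ≤ R → 2 * R₀ ≤ R →
      ∫ z, radialWeight n cutoffProfile z * Real.exp (2 * u (R • z)) ≤ C * R ^ (p - 2) := by
  set ρ := radialWeight n cutoffProfile with hρ
  have hρc : Continuous ρ := (contDiff_radialWeight contDiff_cutoffProfile).continuous
  have hρs : HasCompactSupport ρ := hasCompactSupport_radialWeight cutoffProfile_eq_zero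
  obtain ⟨b, hb⟩ := hρc.bounded_above_of_compact_support hρs
  have hb0 : 0 ≤ b := (norm_nonneg _).trans (hb 0)
  refine ⟨b * E / c, fun R hR hRR => ?_⟩
  have hR0 : 0 < R := by linarith
  have hv : ContDiff ℝ ∞ (fun z => u (R • z)) := contDiff_comp_smul hu R
  set S : Set (EuclSp n) := {z | R₀ < ‖R • z‖} with hS
  have hSm : MeasurableSet S :=
    measurableSet_lt measurable_const (continuous_const_smul R).norm.measurable
  have hc2 : HasCompactSupport (fun z => η z ^ 2) := hc.comp_left (g := fun a => a ^ 2) (by simp)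
  have iP : Integrable (fun z => η z ^ 2 * scalarPart (fun z => u (R • z)) z) :=
    ((hη.continuous.pow 2).mul (continuous_scalarPart hv)).integrable_of_hasCompactSupport
      hc2.mul_right
  have iρ : Integrable (fun z => ρ z * Real.exp (2 * u (R • z))) :=
    Continuous.integrable_of_hasCompactSupport
      (hρc.mul (Real.continuous_exp.comp (continuous_const.mul hv.continuous))) hρs.mul_right
  have hlow : ∀ x, R₀ < ‖x‖ → 0 ≤ scalarPart u x := fun x hx =>
    le_trans (by positivity) (hP x hx)
  have hpt : ∀ z, c * R ^ (2 - p) * (ρ z * Real.exp (2 * u (R • z))) ≤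
      b * S.indicator (fun z => η z ^ 2 * scalarPart (fun z => u (R • z)) z) z := by
    intro z
    by_cases hz : 1 / 2 < ‖z‖ ∧ ‖z‖ ≤ 1
    · have hnorm : ‖R • z‖ = R * ‖z‖ := by rw [norm_smul, Real.norm_of_nonneg hR0.le]
      have hzS : R₀ < ‖R • z‖ := by rw [hnorm]; nlinarith [hz.1]
      have hz0 : 0 < ‖z‖ := by linarith [hz.1]
      rw [indicator_of_mem (show z ∈ S from hzS), hη1 z hz.2, one_pow, one_mul,
        scalarPart_comp_smul hu]
      have h1 := hP _ hzS
      have h2 : R ^ (-p) ≤ ‖R • z‖ ^ (-p) := by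
        rw [hnorm]
        exact Real.rpow_le_rpow_of_nonpos (mul_pos hR0 hz0) (mul_le_of_le_one_right hR0.le hz.2)
          (by linarith)
      have h3 : R ^ (2 - p) = R ^ 2 * R ^ (-p) := by
        rw [sub_eq_add_neg, Real.rpow_add hR0]
        norm_num
      have h4 : ρ z ≤ b := (le_abs_self _).trans (hb z)
      have hx := Real.exp_pos (2 * u (R • z))
      rw [h3]
      calc c * (R ^ 2 * R ^ (-p)) * (ρ z * Real.exp (2 * u (R • z)))
          = ρ z * (R ^ 2 * (c * R ^ (-p) * Real.exp (2 * u (R • z)))) := by ring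
        _ ≤ b * (R ^ 2 * (c * R ^ (-p) * Real.exp (2 * u (R • z)))) := by
            refine mul_le_mul_of_nonneg_right h4 ?_
            positivity
        _ ≤ b * (R ^ 2 * scalarPart u (R • z)) := by
            refine mul_le_mul_of_nonneg_left (mul_le_mul_of_nonneg_left (le_trans ?_ h1)
              (sq_nonneg _)) hb0
            exact mul_le_mul_of_nonneg_right (mul_le_mul_of_nonneg_left h2 hc0.le) hx.le
    · have hρz : ρ z = 0 := by
        rcases not_and_or.mp hz with h | h
        · exact radialWeight_cutoffProfile_eq_zero (not_lt.mp h)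
        · exact radialWeight_eq_zero cutoffProfile_eq_zero (not_le.mp h)
      rw [hρz, zero_mul, mul_zero]
      refine mul_nonneg hb0 (indicator_nonneg (fun z hz => ?_) z)
      rw [scalarPart_comp_smul hu]
      exact mul_nonneg (sq_nonneg _) (mul_nonneg (sq_nonneg _) (hlow _ hz))
  have h := integral_mono (iρ.const_mul _) ((iP.indicator hSm).const_mul b) hpt
  rw [integral_const_mul, integral_const_mul] at h
  have h2 := h.trans (mul_le_mul_of_nonneg_left (hE R hR) hb0)
  have h3 : R ^ (2 - p) * R ^ (p - 2) = 1 := by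
    rw [← Real.rpow_add hR0]
    simp
  have h4 := mul_le_mul_of_nonneg_right h2 (Real.rpow_nonneg hR0.le (p - 2))
  rw [div_mul_eq_mul_div, le_div_iff₀ hc0]
  calc (∫ z, ρ z * Real.exp (2 * u (R • z))) * c
      = c * (R ^ (2 - p) * R ^ (p - 2)) * (∫ z, ρ z * Real.exp (2 * u (R • z))) := by
        rw [h3]; ring
    _ = c * R ^ (2 - p) * (∫ z, ρ z * Real.exp (2 * u (R • z))) * R ^ (p - 2) := by ring
    _ ≤ _ := h4

end Means

/-! ### Volume growth and entropy -/

section VolumeGrowth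

variable {n : ℕ}

lemma setIntegral_annulus_comp_smul (f : EuclSp n → ℝ) {R : ℝ} (hR : 0 < R) (a b : ℝ) :
    R ^ n * ∫ z in annulus n a b, f (R • z) = ∫ x in annulus n (R * a) (R * b), f x := by
  have hm : ∀ a b, MeasurableSet (annulus n a b) := fun a b => (isCompact_annulus n a b).measurableSet
  rw [← integral_indicator (hm _ _), ← integral_indicator (hm _ _)]
  have e : (annulus n a b).indicator (fun z => f (R • z)) =
      fun z => (annulus n (R * a) (R * b)).indicator f (R • z) := by
    ext z
    have : z ∈ annulus n a b ↔ R • z ∈ annulus n (R * a) (R * b) := by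
      simp only [annulus, mem_ofPred_eq, norm_smul, Real.norm_of_nonneg hR.le,
        mul_le_mul_iff_right₀ hR]
    by_cases hz : z ∈ annulus n a b
    · rw [indicator_of_mem hz, indicator_of_mem (this.mp hz)]
    · rw [indicator_of_notMem hz, indicator_of_notMem (fun h => hz (this.mpr h))]
  rw [e, Measure.integral_comp_smul, finrank_euclideanSpace_fin, smul_eq_mul,
    abs_of_nonneg (by positivity), ← mul_assoc, mul_inv_cancel₀ (by positivity), one_mul]

lemma exists_setIntegral_compl_ball_le {f : EuclSp n → ℝ} (hf : Integrable f) {δ : ℝ} (hδ : 0 < δ) :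
    ∃ R₁ : ℝ, ∀ R ≥ R₁, ∀ b, ∫ x in annulus n R b, |f x| ≤ δ := by
  have hanti : Antitone fun k : ℕ => {x : EuclSp n | (k : ℝ) ≤ ‖x‖} := by
    intro i j hij x hx
    exact le_trans (Nat.cast_le.mpr hij) (show (j : ℝ) ≤ ‖x‖ from hx)
  have hlim := tendsto_setIntegral_of_antitone (μ := volume) (f := fun x => |f x|)
    (fun k : ℕ => measurableSet_le measurable_const measurable_norm) hanti
    ⟨0, hf.abs.integrableOn⟩
  have hempty : ⋂ k : ℕ, {x : EuclSp n | (k : ℝ) ≤ ‖x‖} = ∅ := by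
    ext x
    simp only [mem_iInter, mem_ofPred_eq, mem_empty_iff_false, iff_false, not_forall, not_le]
    exact exists_nat_gt ‖x‖
  rw [hempty, setIntegral_empty] at hlim
  obtain ⟨k, hk⟩ := (hlim.eventually (gt_mem_nhds hδ)).exists
  refine ⟨k, fun R hR b => ?_⟩
  refine le_trans (setIntegral_mono_set hf.abs.integrableOn
    (Eventually.of_forall fun x => abs_nonneg _) ?_) hk.le
  exact (show annulus n R b ⊆ _ from fun x hx => le_trans hR hx.1).eventuallyLE

lemma exists_cutoff (n : ℕ) : ∃ η : EuclSp n → ℝ, ContDiff ℝ ∞ η ∧ HasCompactSupport η ∧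
    (∀ z, ‖z‖ ≤ 6 → η z = 1) ∧ ∀ z, η z ^ 2 ≤ 1 := by
  let η : ContDiffBump (0 : EuclSp n) := ⟨6, 7, by norm_num, by norm_num⟩
  exact ⟨η, η.contDiff, η.hasCompactSupport,
    fun z hz => η.one_of_mem_closedBall (by simpa [η] using hz),
    fun z => pow_le_one₀ η.nonneg η.le_one⟩

/-- The volume of annuli: rescaling to unit size, the local estimate bounds the volume by the
exponential of a mean of `u`, and this mean is bounded above in two ways. -/
lemma exists_annulus_volume_le {n m : ℕ} (hn : n = 2 * m) (hm : 2 ≤ m) {u : EuclSp n → ℝ} (hu : ContDiff ℝ ∞ u)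
    (hQ : Integrable (negLap^[m] u)) {R₀ c p : ℝ} (hc0 : 0 < c) (hp : 0 ≤ p)
    (hP : ∀ x, R₀ < ‖x‖ → c * ‖x‖ ^ (-p) * Real.exp (2 * u x) ≤ scalarPart u x) :
    ∃ C R₁ : ℝ, 0 ≤ C ∧ 1 ≤ R₁ ∧ ∀ R ≥ R₁,
      ∫ x in annulus n (R * 2) (R * 4), Real.exp (n * u x) ≤
        C * R ^ (n * min 1 (p / 2)) := by
  have hnpos : (0 : ℝ) < (n : ℕ) := by exact_mod_cast (by omega : 0 < n)
  have hn2 : (2 : ℝ) ≤ (n : ℕ) := by exact_mod_cast (by omega : 2 ≤ n)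
  have hlow : ∀ x, R₀ < ‖x‖ → 0 ≤ scalarPart u x := fun x hx =>
    le_trans (by positivity) (hP x hx)
  have hsup : ∀ x, R₀ < ‖x‖ → 0 ≤ negLap u x := by
    intro x hx
    have h := hlow x hx
    have h2 := mul_nonneg (sub_nonneg.mpr hn2) (gradSq_nonneg u x)
    rw [scalarPart] at h
    linarith
  set d := ∫ z, radialWeight n cutoffProfile z with hd
  have hd0 : 0 < d := integral_radialWeight_cutoffProfile_pos (by omega)
  obtain ⟨η, hη, hηc, hη6, hη1⟩ := exists_cutoff n
  obtain ⟨E, hE⟩ := exists_energy_bound (by omega) hu hη hηc hη1 hlow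
  obtain ⟨δ, hδ, hloc⟩ := exists_local_bound hn (by omega)
  obtain ⟨C₁, hC₁, hloc⟩ := hloc (max E 0) (le_max_right _ _)
  obtain ⟨C₂, hC₂⟩ := exists_integral_radialWeight_mul_le (by omega) hu hsup
  obtain ⟨C₃, hC₃⟩ := exists_integral_radialWeight_mul_exp_le hu hη hηc
    (fun z hz => hη6 z (by linarith)) hc0 hp hP (fun R hR => (hE R hR).2)
  obtain ⟨R₂, hR₂⟩ := exists_setIntegral_compl_ball_le hQ hδ
  set D₁ := Real.exp (n * (C₂ / d)) with hD₁
  set D₂ := (C₃ / d) ^ m with hD₂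
  refine ⟨C₁ * max D₁ D₂, max 1 (max (2 * R₀) R₂), mul_nonneg hC₁.le
    ((Real.exp_pos _).le.trans (le_max_left _ _)), le_max_left _ _, fun R hR => ?_⟩
  have hR1 : 1 ≤ R := (le_max_left _ _).trans hR
  have hR0 : 0 < R := by linarith
  have hRR₀ : 2 * R₀ ≤ R := ((le_max_left _ _).trans (le_max_right _ _)).trans hR
  have hRR₂ : R₂ ≤ R := ((le_max_right _ _).trans (le_max_right _ _)).trans hR
  set v : EuclSp n → ℝ := fun z => u (R • z) with hvdef
  have hv : ContDiff ℝ ∞ v := contDiff_comp_smul hu R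
  have hvE : ∫ z in Metric.closedBall 0 6, gradSq v z ≤ max E 0 := by
    refine le_trans ?_ ((hE R hR1).1.trans (le_max_left _ _))
    have hηc2 : HasCompactSupport (fun z => η z ^ 2) := hηc.comp_left (g := fun a => a ^ 2) (by simp)
    have hi : Integrable fun z => η z ^ 2 * gradSq v z :=
      ((hη.continuous.pow 2).mul (continuous_gradSq hv)).integrable_of_hasCompactSupport
        hηc2.mul_right
    refine le_trans (le_of_eq ?_) (setIntegral_le_integral (s := Metric.closedBall 0 6) hi
      (Eventually.of_forall fun z => mul_nonneg (sq_nonneg _) (gradSq_nonneg _ _)))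
    refine setIntegral_congr_fun measurableSet_closedBall fun z hz => ?_
    rw [hη6 z (by simpa using hz), one_pow, one_mul]
  have hvδ : ∫ z in annulus n 1 5, |negLap^[m] v z| ≤ δ := by
    have e : ∀ z, |negLap^[m] v z| = R ^ n * |negLap^[m] u (R • z)| := fun z => by
      rw [hvdef, iterate_negLap_comp_smul hu R m z, ← hn, abs_mul, abs_of_nonneg (by positivity)]
    simp_rw [e]
    rw [integral_const_mul, setIntegral_annulus_comp_smul (fun x => |negLap^[m] u x|) hR0]
    exact hR₂ _ (by linarith) _
  have hmain := hloc v hv hvE hvδ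
  set M := annularMean v with hM
  have hM1 : Real.exp (n * M) ≤ D₁ := by
    refine Real.exp_le_exp.mpr (mul_le_mul_of_nonneg_left ?_ hnpos.le)
    exact div_le_div_of_nonneg_right (hC₂ R hR1) hd0.le
  have hM2 : Real.exp (n * M) ≤ D₂ * R ^ (n * (p / 2 - 1)) := by
    have h1 : Real.exp (2 * M) ≤ C₃ / d * R ^ (p - 2) := by
      have := (exp_annularMean_le (by omega) hv.continuous).trans (hC₃ R hR1 hRR₀)
      rw [div_mul_eq_mul_div, le_div_iff₀ hd0]
      linarith
    have h2 : Real.exp (n * M) = Real.exp (2 * M) ^ m := by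
      rw [← Real.exp_nat_mul, hn]
      congr 1
      push_cast
      ring
    have h3 : R ^ (n * (p / 2 - 1)) = (R ^ (p - 2)) ^ m := by
      rw [← Real.rpow_natCast, ← Real.rpow_mul hR0.le, hn]
      congr 1
      push_cast
      ring
    rw [h2, h3, ← mul_pow]
    exact pow_le_pow_left₀ (Real.exp_pos _).le h1 m
  -- The better of the two bounds is `hM1` for `p ≥ 2` and `hM2` for `p ≤ 2`.
  have hM3 : R ^ n * Real.exp (n * M) ≤ max D₁ D₂ * R ^ (n * min 1 (p / 2)) := by
    have hRn : R ^ n = R ^ ((n : ℕ) : ℝ) := (Real.rpow_natCast R n).symm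
    rcases le_total 1 (p / 2) with h | h
    · rw [min_eq_left h, mul_one, hRn, mul_comm]
      exact mul_le_mul_of_nonneg_right (hM1.trans (le_max_left _ _)) (by positivity)
    · rw [min_eq_right h]
      calc R ^ n * Real.exp (n * M) ≤ R ^ n * (D₂ * R ^ (n * (p / 2 - 1))) :=
            mul_le_mul_of_nonneg_left hM2 (by positivity)
        _ = D₂ * R ^ (n * (p / 2)) := by
            rw [hRn, mul_left_comm, ← Real.rpow_add hR0]
            ring_nf
        _ ≤ _ := mul_le_mul_of_nonneg_right (le_max_right _ _) (by positivity)
  rw [← setIntegral_annulus_comp_smul (fun x => Real.exp (n * u x)) hR0]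
  calc R ^ n * ∫ z in annulus n 2 4, Real.exp (n * u (R • z))
      ≤ R ^ n * (C₁ * Real.exp (n * M)) := mul_le_mul_of_nonneg_left hmain (by positivity)
    _ = C₁ * (R ^ n * Real.exp (n * M)) := by ring
    _ ≤ C₁ * (max D₁ D₂ * R ^ (n * min 1 (p / 2))) := mul_le_mul_of_nonneg_left hM3 hC₁.le
    _ = _ := by ring

/-- A monotone function whose dyadic increments are `O(r^q)` with `q > 0` is itself `O(r^q)`. -/
lemma exists_le_mul_rpow_of_dyadic {V : ℝ → ℝ} (hV : Monotone V) {r₀ C q : ℝ} (hr₀ : 1 ≤ r₀)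
    (hq : 0 < q) (h : ∀ r ≥ r₀, V r ≤ V (r / 2) + C * r ^ q) :
    ∃ D : ℝ, 0 < D ∧ ∀ r ≥ r₀, V r ≤ D * r ^ q := by
  have h2q : (2 : ℝ) ^ (-q) < 1 := Real.rpow_lt_one_of_one_lt_of_neg (by norm_num) (by linarith)
  set D := max 1 (max (V r₀ / (r₀ / 2) ^ q) (C / (1 - 2 ^ (-q)))) with hD
  have hD0 : 0 < D := zero_lt_one.trans_le (le_max_left _ _)
  have hDV : V r₀ ≤ D * (r₀ / 2) ^ q := by
    have : V r₀ / (r₀ / 2) ^ q ≤ D := (le_max_left _ _).trans (le_max_right _ _)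
    rwa [div_le_iff₀ (by positivity)] at this
  have hDC : C ≤ D * (1 - 2 ^ (-q)) := by
    have : C / (1 - 2 ^ (-q)) ≤ D := (le_max_right _ _).trans (le_max_right _ _)
    rwa [div_le_iff₀ (by linarith)] at this
  have key : ∀ k : ℕ, ∀ r, r₀ / 2 ≤ r → r ≤ r₀ * 2 ^ k → V r ≤ D * r ^ q := by
    intro k
    induction k with
    | zero =>
      intro r h1 h2
      refine (hV (by simpa using h2)).trans (hDV.trans ?_)
      exact mul_le_mul_of_nonneg_left (Real.rpow_le_rpow (by linarith) h1 hq.le) hD0.le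
    | succ k ih =>
      intro r h1 h2
      rcases le_total r r₀ with hr | hr
      · refine (hV hr).trans (hDV.trans ?_)
        exact mul_le_mul_of_nonneg_left (Real.rpow_le_rpow (by linarith) h1 hq.le) hD0.le
      · have hr0 : 0 < r := by linarith
        have h3 := ih (r / 2) (by linarith) (by rw [pow_succ] at h2; linarith)
        have h4 : (r / 2) ^ q = 2 ^ (-q) * r ^ q := by
          rw [Real.div_rpow hr0.le (by norm_num), Real.rpow_neg (by norm_num)]
          field_simp
        have h5 := mul_le_mul_of_nonneg_right hDC (Real.rpow_nonneg hr0.le q)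
        have h6 := h r hr
        rw [h4] at h3
        linarith
  refine ⟨D, hD0, fun r hr => ?_⟩
  obtain ⟨k, hk⟩ := pow_unbounded_of_one_lt r (one_lt_two : (1 : ℝ) < 2)
  have hk0 : (0 : ℝ) < 2 ^ k := by positivity
  exact key k r (by linarith) (by nlinarith)

lemma volumeMeasure_real_ball {u : EuclSp n → ℝ} (hu : Continuous u) (r : ℝ) :
    (conformalMetric u).volumeMeasure.real (Metric.ball 0 r) =
      ∫ x in Metric.ball 0 r, Real.exp (n * u x) := by
  rw [volumeMeasure_conformalMetric, Measure.real, withDensity_apply _ measurableSet_ball,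
    integral_eq_lintegral_of_nonneg_ae (Eventually.of_forall fun x => (Real.exp_pos _).le)
      (Continuous.aestronglyMeasurable (by fun_prop))]

/-- Polynomial volume growth of order `q` bounds the volume entropy by `q / n`. -/
lemma volumeEntropy_le_of_growth (hn : 0 < n) {g : MetricField n} {σ : ℝ}
    (h : ∀ q, n * σ < q → ∃ D r₀ : ℝ, 0 < D ∧ ∀ r ≥ r₀,
      0 < g.volumeMeasure.real (Metric.ball 0 r) ∧
      g.volumeMeasure.real (Metric.ball 0 r) ≤ D * r ^ q) :
    g.volumeEntropy ≤ (σ : EReal) := by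
  have hnpos : (0 : ℝ) < n := by exact_mod_cast hn
  refine EReal.le_of_forall_lt_iff_le.mp fun a ha => ?_
  have ha : σ < a := by exact_mod_cast ha
  obtain ⟨D, r₀, hD, hgrow⟩ := h (n * ((σ + a) / 2)) (by nlinarith)
  set κ := volume.real (Metric.ball (0 : EuclSp n) 1) with hκ
  have hκ0 : 0 < κ :=
    ENNReal.toReal_pos (Metric.measure_ball_pos _ _ one_pos).ne' measure_ball_lt_top.ne
  rw [MetricField.volumeEntropy]
  refine limsup_le_of_le (h := ?_)
  have hlog := Real.tendsto_log_atTop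
  have hgap : 0 < n * ((a - σ) / 2) := mul_pos hnpos (by linarith)
  have e1 := hlog.eventually_ge_atTop ((Real.log D - a * Real.log κ) / (n * ((a - σ) / 2)))
  have e2 := hlog.eventually_ge_atTop ((1 - Real.log κ) / n)
  filter_upwards [e1, e2, eventually_ge_atTop r₀, eventually_gt_atTop 0] with r h1 h2 hr hr0
  rw [div_le_iff₀ hgap] at h1
  rw [div_le_iff₀ hnpos] at h2
  obtain ⟨hV0, hV⟩ := hgrow r hr
  have hball : Real.log (volume.real (Metric.ball (0 : EuclSp n) r)) =
      n * Real.log r + Real.log κ := by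
    rw [Measure.real, Measure.addHaar_ball_of_pos _ _ hr0, ENNReal.toReal_mul,
      ENNReal.toReal_ofReal (by positivity), ← Measure.real, ← hκ, finrank_euclideanSpace_fin,
      Real.log_mul (by positivity) hκ0.ne', Real.log_pow]
  have hlogV : Real.log (g.volumeMeasure.real (Metric.ball 0 r)) ≤
      Real.log D + n * ((σ + a) / 2) * Real.log r := by
    refine (Real.log_le_log hV0 hV).trans_eq ?_
    rw [Real.log_mul hD.ne' (by positivity), Real.log_rpow hr0]
  refine EReal.coe_le_coe_iff.mpr ?_
  rw [hball, div_le_iff₀ (by linarith)]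
  linarith

end VolumeGrowth

theorem mainTheorem10 (n : ℕ) (hn : 4 ≤ n) (hn_even : Even n)
    (u : EuclSp n → ℝ) (hu : ContDiff ℝ ∞ u)
    (hcomplete : (conformalMetric u).IsCompleteMetric)
    (hQ : FiniteTotalQCurvature u)
    (C p : ℝ) (hC : 0 < C) (hp : 0 ≤ p)
    (hR : ∃ K : Set (EuclSp n), IsCompact K ∧
      ∀ x ∉ K, C * ‖x‖ ^ (-p) ≤ (conformalMetric u).scalarCurvature x) :
    (conformalMetric u).volumeEntropy ≤ ((min 1 (p / 2) : ℝ) : EReal) := by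
  obtain ⟨m, rfl⟩ : ∃ m, n = 2 * m := hn_even.two_dvd
  obtain ⟨K, hK, hKR⟩ := hR
  obtain ⟨R₀, hR₀⟩ := hK.isBounded.subset_closedBall 0
  have hn1 : (0 : ℝ) < ((2 * m : ℕ) : ℝ) - 1 := by
    have : (4 : ℝ) ≤ ((2 * m : ℕ) : ℝ) := by exact_mod_cast hn
    linarith
  have hP : ∀ x, R₀ < ‖x‖ →
      C / (((2 * m : ℕ) : ℝ) - 1) * ‖x‖ ^ (-p) * Real.exp (2 * u x) ≤ scalarPart u x := by
    intro x hx
    have h := hKR x fun hxK => absurd (hR₀ hxK) (by simpa using hx)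
    rw [scalarCurvature_conformalMetric hu, ← scalarPart] at h
    have h2 := mul_le_mul_of_nonneg_right h (Real.exp_pos (2 * u x)).le
    have e : Real.exp (-(2 * u x)) * Real.exp (2 * u x) = 1 := by rw [← Real.exp_add]; simp
    rw [div_mul_eq_mul_div, div_mul_eq_mul_div, div_le_iff₀ hn1]
    calc _ ≤ _ := h2
      _ = (Real.exp (-(2 * u x)) * Real.exp (2 * u x)) *
          (scalarPart u x * (((2 * m : ℕ) : ℝ) - 1)) := by ring
      _ = _ := by rw [e, one_mul]
  have hQ' : Integrable (negLap^[m] u) := by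
    refine hQ.congr (Eventually.of_forall fun x => ?_)
    have e : Real.exp (-((2 * m : ℕ) * u x)) * Real.exp ((2 * m : ℕ) * u x) = 1 := by
      rw [← Real.exp_add]; simp
    have e2 : 2 * m / 2 = m := by omega
    simp only [qCurvature, e2]
    rw [mul_right_comm, e, one_mul]
    rfl
  obtain ⟨A, R₁, hA, hR₁, hann⟩ := exists_annulus_volume_le rfl (by omega) hu hQ'
    (div_pos hC hn1) hp hP
  set V : ℝ → ℝ := fun r => ∫ x in Metric.ball 0 r, Real.exp ((2 * m : ℕ) * u x) with hVdef
  have hcont : Continuous fun x => Real.exp ((2 * m : ℕ) * u x) := by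
    have := hu.continuous
    fun_prop
  have hint : ∀ r, IntegrableOn (fun x => Real.exp ((2 * m : ℕ) * u x)) (Metric.ball 0 r) :=
    fun r => (hcont.continuousOn.integrableOn_compact (isCompact_closedBall 0 r)).mono_set
      Metric.ball_subset_closedBall
  have hmono : Monotone V := fun r s hrs => setIntegral_mono_set (hint s)
    (Eventually.of_forall fun x => (Real.exp_pos _).le) (Metric.ball_subset_ball hrs).eventuallyLE
  refine volumeEntropy_le_of_growth (by omega) fun q hq => ?_
  simp_rw [volumeMeasure_real_ball hu.continuous]
  have hσ : 0 ≤ ((2 * m : ℕ) : ℝ) * min 1 (p / 2) :=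
    mul_nonneg (Nat.cast_nonneg _) (le_min zero_le_one (by linarith))
  have hdy : ∀ r ≥ 4 * R₁, V r ≤ V (r / 2) + A * r ^ q := by
    intro r hr
    have hr1 : 1 ≤ r / 4 := by linarith
    have hsub : Metric.ball (0 : EuclSp (2 * m)) r ⊆
        Metric.ball 0 (r / 2) ∪ annulus (2 * m) (r / 4 * 2) (r / 4 * 4) := by
      intro x hx
      have hx' : ‖x‖ < r := by simpa using hx
      rcases lt_or_ge ‖x‖ (r / 2) with h | h
      · left; simpa using h
      · right; exact ⟨by linarith, by linarith⟩
    have hintA : IntegrableOn (fun x => Real.exp ((2 * m : ℕ) * u x))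
        (annulus (2 * m) (r / 4 * 2) (r / 4 * 4)) :=
      hcont.continuousOn.integrableOn_compact (isCompact_annulus _ _ _)
    have h1 : V r ≤ V (r / 2) +
        ∫ x in annulus (2 * m) (r / 4 * 2) (r / 4 * 4), Real.exp ((2 * m : ℕ) * u x) := by
      refine (setIntegral_mono_set ((hint _).union hintA)
        (Eventually.of_forall fun x => (Real.exp_pos _).le) hsub.eventuallyLE).trans ?_
      exact (setIntegral_union (Set.disjoint_left.mpr fun x hx hx' => by
        have h1 : ‖x‖ < r / 2 := by simpa using hx
        linarith [hx'.1]) (isCompact_annulus _ _ _).measurableSet (hint _) hintA).le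
    refine h1.trans (by
      refine add_le_add_right ((hann (r / 4) (by linarith)).trans ?_) _
      refine mul_le_mul_of_nonneg_left ?_ hA
      calc (r / 4) ^ (((2 * m : ℕ) : ℝ) * min 1 (p / 2)) ≤ (r / 4) ^ q :=
            Real.rpow_le_rpow_of_exponent_le hr1 hq.le
        _ ≤ r ^ q := Real.rpow_le_rpow (by linarith) (by linarith) (hσ.trans hq.le))
  obtain ⟨D, hD, hgrow⟩ := exists_le_mul_rpow_of_dyadic hmono (by linarith) (hσ.trans_lt hq) hdy
  refine ⟨D, 4 * R₁, hD, fun r hr => ⟨?_, hgrow r hr⟩⟩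
  rw [setIntegral_pos_iff_support_of_nonneg_ae
    (Eventually.of_forall fun x => (Real.exp_pos _).le) (hint r)]
  have hsupp : Function.support (fun x => Real.exp ((2 * m : ℕ) * u x)) = univ := by
    ext x
    simp [(Real.exp_pos _).ne']
  rw [hsupp, univ_inter]
  exact Metric.measure_ball_pos _ _ (by linarith)
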